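/- Let $\mathcal{K}=\mathbb{C}(\!(t)\!)$ be the field of formal Laurent series with the derivation $d=t\frac{d}{dt}$. For a positive integer $b$ let $\mathcal{K}_b=\mathbb{C}(\!(t^{1/b})\!)$, a finite extension of $\mathcal{K}$ of degree $b$, with the derivation $d_b$ that extends $d$; explicitly, $d_b=\frac1b\, s\frac{d}{ds}$ where $s=t^{1/b}$. For a commutative ring $R$ with a derivation $\delta$, let $R\{x,\delta\}$ be the ring of differential polynomials: its additive group is that of $R[x]$, and its multiplication is determined by $xa=ax+\delta(a)$ for $a\in R$. Write $\mathcal{K}\{x\}=\mathcal{K}\{x,d\}$ and $\mathcal{K}_b\{x\}=\mathcal{K}_b\{x,d_b\}$, so that $\mathcal{K}\{x\}$ is a subring of $\mathcal{K}_b\{x\}$. **Theorem.** Every differential polynomial in $\mathcal{K}\{x\}$ has a linear factorisation over some finite extension $\mathcal{K}_b$ of $\mathcal{K}$. That is, for every $f=a_0x^n+a_1x^{n-1}+\cdots+a_n\in\mathcal{K}\{x\}$ with $a_i\in\mathcal{K}$ and $a_0\neq 0$ there are a positive integer $b$ and elements $\Lambda_1,\dots,\Lambda_n\in\mathcal{K}_b$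 such that $$f=a_0\,(x-\Lambda_1)(x-\Lambda_2)\cdots(x-\Lambda_n)\quad\text{in } \mathcal{K}_b\{x\}.$$ -/

import Mathlib

open Polynomial LaurentSeries

noncomputable section

/-! ## Differential polynomials -/

section DifferentialPolynomials

/-- Derivations of a commutative ring `R`: additive maps `R → R` that satisfy the Leibniz rule. -/
abbrev Der (R : Type*) [CommRing R] := Derivation ℤ R R

/-- The derivation given by an additive map that satisfies the Leibniz rule. -/
def Der.ofAddHom {R : Type*} [CommRing R] (D : R →+ R)
    (h : ∀ a b, D (a * b) = a * D b + b * D a) : Der R :=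
  Derivation.mk' D.toIntLinearMap h

theorem Der.ofAddHom_apply {R : Type*} [CommRing R] (D : R →+ R)
    (h : ∀ a b, D (a * b) = a * D b + b * D a) (a : R) : Der.ofAddHom D h a = D a := rfl

variable {R : Type*} [CommRing R] (d : Der R)

/-- Left multiplication by the variable `x` on the ring of differential polynomials, written on
the underlying additive group `R[x]`: since `x a = a x + d a`, it sends `∑ aₙ xⁿ` to
`∑ aₙ xⁿ⁺¹ + ∑ d(aₙ) xⁿ`. -/
def varMul : AddMonoid.End R[X] where
  toFun p := X * p + p.sum fun n a => monomial n (d a)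
  map_zero' := by simp
  map_add' p q := by
    rw [Polynomial.sum_add_index p q _ (by simp) (by intros; simp)]
    ring

/-- The action of `∑ aₙ xⁿ` on `R[x]` by left multiplication, i.e. the additive map
`g ↦ ∑ aₙ • (varMul d)ⁿ g`. -/
def leftMul : R[X] →+ AddMonoid.End R[X] :=
  eval₂AddMonoidHom (Module.toAddMonoidEnd R R[X]) (varMul d)

/-- The ring `R{x, d}` of differential polynomials over the differential ring `(R, d)`: its
additive group is `R[x]`, and the multiplication is determined by `x a = a x + d a`. -/
def DiffPoly (_d : Der R) : Type _ := R[X]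

namespace DiffPoly

theorem end_add_apply {M : Type*} [AddCommGroup M] (f g : AddMonoid.End M) (x : M) :
    (f + g) x = f x + g x := rfl

theorem end_mul_apply {M : Type*} [AddCommGroup M] (f g : AddMonoid.End M) (x : M) :
    (f * g) x = f (g x) := rfl

instance : AddCommGroup (DiffPoly d) := inferInstanceAs (AddCommGroup R[X])

/-- The identity map of additive groups `R[x] = R{x, d}`. -/
def ofPoly : R[X] ≃+ DiffPoly d := AddEquiv.refl R[X]

/-- `(∑ aₙ xⁿ) * g = ∑ aₙ (xⁿ g)`, where `x` acts on `g` from the left by `varMul d`. -/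
instance : Mul (DiffPoly d) :=
  ⟨fun f g => ofPoly d (leftMul d ((ofPoly d).symm f) ((ofPoly d).symm g))⟩

instance : One (DiffPoly d) := ⟨ofPoly d 1⟩

theorem varMul_monomial (n : ℕ) (a : R) :
    varMul d (monomial n a) = monomial (n + 1) a + monomial n (d a) := by
  change X * monomial n a + (monomial n a).sum (fun n a => monomial n (d a)) = _
  rw [X_mul_monomial, sum_monomial_index _ _ (by simp)]

theorem leftMul_monomial (n : ℕ) (a : R) (g : R[X]) :
    leftMul d (monomial n a) g = a • ((varMul d) ^ n) g := by
  change (eval₂ (Module.toAddMonoidEnd R R[X]) (varMul d) (monomial n a)) g = _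
  rw [eval₂_monomial]
  rfl

theorem varMul_smul (a : R) (g : R[X]) :
    varMul d (a • g) = a • varMul d g + d a • g := by
  induction g using Polynomial.induction_on' with
  | add p q hp hq => simp only [smul_add, map_add, hp, hq]; abel
  | monomial n b =>
    simp only [smul_monomial, varMul_monomial, smul_add, smul_eq_mul, Derivation.leibniz, map_add]
    rw [mul_comm b (d a)]
    abel

theorem leftMul_smul (a : R) (f g : R[X]) : leftMul d (a • f) g = a • leftMul d f g := by
  induction f using Polynomial.induction_on' with
  | add p q hp hq => simp only [smul_add, map_add, end_add_apply, hp, hq]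
  | monomial n b => simp [smul_monomial, leftMul_monomial, mul_smul]

theorem leftMul_varMul (f g : R[X]) : leftMul d (varMul d f) g = varMul d (leftMul d f g) := by
  induction f using Polynomial.induction_on' with
  | add p q hp hq => simp only [map_add, end_add_apply, hp, hq]
  | monomial n b =>
    simp only [varMul_monomial, map_add, end_add_apply, leftMul_monomial, varMul_smul,
      pow_succ', end_mul_apply]

theorem leftMul_varMul_pow (n : ℕ) (f g : R[X]) :
    leftMul d ((varMul d ^ n) f) g = (varMul d ^ n) (leftMul d f g) := by
  induction n with
  | zero => simp
  | succ n ih => rw [pow_succ', end_mul_apply, leftMul_varMul, ih,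
      end_mul_apply]

theorem leftMul_leftMul (f g h : R[X]) :
    leftMul d (leftMul d f g) h = leftMul d f (leftMul d g h) := by
  induction f using Polynomial.induction_on' with
  | add p q hp hq => simp only [map_add, end_add_apply, hp, hq]
  | monomial n b => simp only [leftMul_monomial, leftMul_smul, leftMul_varMul_pow]

theorem leftMul_one (g : R[X]) : leftMul d 1 g = g := by
  rw [← monomial_zero_one, leftMul_monomial]; simp

theorem varMul_pow_one (n : ℕ) : (varMul d ^ n) 1 = monomial n 1 := by
  induction n with
  | zero => simp
  | succ n ih =>
    rw [pow_succ', end_mul_apply, ih, varMul_monomial]; simp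

theorem leftMul_apply_one (f : R[X]) : leftMul d f 1 = f := by
  induction f using Polynomial.induction_on' with
  | add p q hp hq => simp only [map_add, end_add_apply, hp, hq]
  | monomial n b => simp [leftMul_monomial, varMul_pow_one, smul_monomial]

instance : Ring (DiffPoly d) where
  __ := (inferInstance : AddCommGroup (DiffPoly d))
  __ := (inferInstance : Mul (DiffPoly d))
  __ := (inferInstance : One (DiffPoly d))
  mul_assoc f g h := leftMul_leftMul d f g h
  one_mul f := leftMul_one d f
  mul_one f := leftMul_apply_one d f
  left_distrib f g h := map_add (leftMul d f) g h
  right_distrib f g h := DFunLike.congr_fun (map_add (leftMul d) f g) h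
  zero_mul f := DFunLike.congr_fun (map_zero (leftMul d)) f
  mul_zero f := map_zero (leftMul d f)

/-- The degree of a differential polynomial (with `0` for the zero polynomial). -/
def natDegree (f : DiffPoly d) : ℕ := ((ofPoly d).symm f).natDegree

/-- The coefficient `aₙ` of the highest power in `∑ aᵢ xⁱ`, coefficients on the left. -/
def leadingCoeff (f : DiffPoly d) : R := ((ofPoly d).symm f).leadingCoeff

/-- The variable `x` of `R{x, d}`. -/
def var : DiffPoly d := ofPoly d X

/-- The inclusion of `R` in `R{x, d}`. -/
def const : R →+* DiffPoly d where
  toFun a := ofPoly d (C a)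
  map_one' := rfl
  map_zero' := by simp
  map_add' a b := by simp
  map_mul' a b := by
    change C (a * b) = leftMul d (C a) (C b)
    rw [← monomial_zero_left, ← monomial_zero_left, ← monomial_zero_left, leftMul_monomial]
    simp

/-- The commutation rule that determines the multiplication. -/
theorem var_mul_const (a : R) : var d * const d a = const d a * var d + const d (d a) := by
  change leftMul d X (C a) = leftMul d (C a) X + C (d a)
  rw [← monomial_one_one_eq_X, ← monomial_zero_left, ← monomial_zero_left, leftMul_monomial,
    leftMul_monomial, pow_one, varMul_monomial]
  simp [smul_monomial]

/-- Multiplication by a coefficient on the left and by a power of the variable on the right is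
the same as for ordinary polynomials. -/
theorem const_mul_var_pow (n : ℕ) (a : R) :
    const d a * var d ^ n = ofPoly d (monomial n a) := by
  have h : var d ^ n = ofPoly d (monomial n 1) := by
    induction n with
    | zero => rfl
    | succ n ih =>
      rw [pow_succ', ih]
      change leftMul d X (monomial n 1) = monomial (n + 1) 1
      rw [← monomial_one_one_eq_X, leftMul_monomial]
      simp [varMul_monomial]
  rw [h]
  change leftMul d (C a) (monomial n 1) = monomial n a
  rw [← monomial_zero_left, leftMul_monomial]
  simp [smul_monomial]

variable {d} in
/-- The ring homomorphism `R{x, d} → S{x, d'}`, `∑ aₙ xⁿ ↦ ∑ φ(aₙ) xⁿ`, that is induced by a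
homomorphism `φ : (R, d) → (S, d')` of differential rings. -/
def map {S : Type*} [CommRing S] {d' : Der S} (φ : R →+* S)
    (hφ : ∀ a, d' (φ a) = φ (d a)) : DiffPoly d →+* DiffPoly d' where
  toFun f := ofPoly d' (((ofPoly d).symm f).map φ)
  map_one' := Polynomial.map_one φ
  map_zero' := Polynomial.map_zero φ
  map_add' f g := Polynomial.map_add φ
  map_mul' f g := by
    have hv : ∀ g : R[X], (varMul d g).map φ = varMul d' (g.map φ) := by
      intro g
      induction g using Polynomial.induction_on' with
      | add p q hp hq => simp only [map_add, Polynomial.map_add, hp, hq]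
      | monomial n b => simp [varMul_monomial, hφ]
    have hp : ∀ (n : ℕ) (g : R[X]), ((varMul d ^ n) g).map φ = (varMul d' ^ n) (g.map φ) := by
      intro n g
      induction n with
      | zero => simp
      | succ n ih => rw [pow_succ', end_mul_apply, hv, ih, pow_succ',
          end_mul_apply]
    change (leftMul d f g).map φ
      = leftMul d' (Polynomial.map φ f) (Polynomial.map φ g)
    generalize (show R[X] from g) = q
    generalize (show R[X] from f) = p
    induction p using Polynomial.induction_on' with
    | add p q hp hq =>
      simp only [map_add, Polynomial.map_add, end_add_apply, hp, hq]
    | monomial n b =>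
      rw [leftMul_monomial, Polynomial.map_monomial, leftMul_monomial, Polynomial.map_smul, hp]

end DiffPoly

end DifferentialPolynomials

/-! ## Formal Laurent series and their finite extensions -/

namespace FormalLaurent

/-- `u * d/du` on `ℂ((u))`, which multiplies the coefficient of `uⁿ` by `n`. -/
theorem coeff_single_one_mul_derivative (f : ℂ⸨X⸩) (n : ℤ) :
    (HahnSeries.single (1 : ℤ) (1 : ℂ) * LaurentSeries.derivative ℂ f).coeff n
      = n * f.coeff n := by
  have h := HahnSeries.coeff_single_mul_add (r := (1 : ℂ)) (x := LaurentSeries.derivative ℂ f)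
    (a := n - 1) (b := (1 : ℤ))
  rw [sub_add_cancel] at h
  rw [h]
  simp

/-- The derivation `u * d/du` of the field `ℂ((u))` of formal Laurent series. -/
def euler : Der ℂ⸨X⸩ :=
  Der.ofAddHom ((AddMonoidHom.mulLeft (HahnSeries.single (1 : ℤ) (1 : ℂ) : ℂ⸨X⸩)).comp
    (LaurentSeries.derivative ℂ).toAddMonoidHom) <| by
    intro f g
    ext n
    change (HahnSeries.single (1 : ℤ) (1 : ℂ) * LaurentSeries.derivative ℂ (f * g)).coeff n
      = (f * (HahnSeries.single (1 : ℤ) (1 : ℂ) * LaurentSeries.derivative ℂ g)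
        + g * (HahnSeries.single (1 : ℤ) (1 : ℂ) * LaurentSeries.derivative ℂ f)).coeff n
    rw [HahnSeries.coeff_add]
    have hsup : ∀ h : ℂ⸨X⸩, (HahnSeries.single (1 : ℤ) (1 : ℂ) *
        LaurentSeries.derivative ℂ h).support ⊆ h.support := by
      intro h m hm
      rw [HahnSeries.mem_support, coeff_single_one_mul_derivative] at hm
      exact right_ne_zero_of_mul hm
    rw [HahnSeries.coeff_mul_right' g.isPWO_support (hsup g), mul_comm g,
      HahnSeries.coeff_mul_left' f.isPWO_support (hsup f), coeff_single_one_mul_derivative,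
      HahnSeries.coeff_mul, Finset.mul_sum, ← Finset.sum_add_distrib]
    refine Finset.sum_congr rfl fun ij hij => ?_
    rw [Finset.mem_antidiagonal] at hij
    rw [coeff_single_one_mul_derivative, coeff_single_one_mul_derivative, ← hij.2.2]
    push_cast
    ring

theorem euler_coeff (f : ℂ⸨X⸩) (n : ℤ) : (euler f).coeff n = n * f.coeff n :=
  coeff_single_one_mul_derivative f n

/-- The field `K = ℂ((t))`. -/
abbrev K : Type := ℂ⸨X⸩

/-- The derivation `d = t * d/dt` of `K`. -/
def d : Der K := euler

/-- The field `K_b = ℂ((t^(1/b)))`, as the field of Laurent series in the variable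
`s = t^(1/b)`. It is regarded as an extension of `K` through `incl b`, that is `t = s ^ b`. -/
abbrev Kb (_b : ℕ+) : Type := ℂ⸨X⸩

/-- The inclusion of `K = ℂ((t))` in `K_b = ℂ((s))`, `∑ aₙ tⁿ ↦ ∑ aₙ s^(b n)`. -/
def incl (b : ℕ+) : K →+* Kb b :=
  HahnSeries.embDomainRingHom (AddMonoidHom.mulLeft (b : ℤ))
    (fun _ _ h => mul_left_cancel₀ (by exact_mod_cast b.ne_zero) h)
    (fun _ _ => mul_le_mul_iff_right₀ (by exact_mod_cast b.pos))

theorem incl_t (b : ℕ+) : incl b (HahnSeries.single 1 1) = (HahnSeries.single 1 1) ^ (b : ℕ) := by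
  rw [HahnSeries.single_pow]
  refine (HahnSeries.embDomain_single (f := ⟨⟨AddMonoidHom.mulLeft (b : ℤ), _⟩, _⟩)).trans ?_
  simp

/-- The extension of `d = t * d/dt` to `K_b`, which is `(1/b) * s * d/ds`. -/
def db (b : ℕ+) : Der (Kb b) := (HahnSeries.C ((b : ℂ)⁻¹) : ℂ⸨X⸩) • euler

theorem db_incl (b : ℕ+) (a : K) : db b (incl b a) = incl b (d a) := by
  have hb : ((b : ℕ) : ℂ) ≠ 0 := by exact_mod_cast b.ne_zero
  ext m
  change (HahnSeries.C ((b : ℂ)⁻¹) * euler (incl b a)).coeff m = _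
  rw [HahnSeries.C_mul_eq_smul, HahnSeries.coeff_smul, smul_eq_mul, euler_coeff]
  by_cases hm : ∃ n : ℤ, m = (b : ℤ) * n
  · obtain ⟨n, rfl⟩ := hm
    have key : ∀ c : K, (incl b c).coeff ((b : ℤ) * n) = c.coeff n := fun c =>
      HahnSeries.embDomain_coeff (f := ⟨⟨AddMonoidHom.mulLeft (b : ℤ), _⟩, _⟩) (a := n)
    rw [key, key, d, euler_coeff]
    push_cast
    field_simp
  · have key : ∀ c : K, (incl b c).coeff m = 0 := fun c =>
      HahnSeries.embDomain_of_notMem_range (by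
        rintro ⟨n, hn⟩
        exact hm ⟨n, hn.symm⟩)
    rw [key, key, mul_zero, mul_zero]

/-- The base change `K{x} → K_b{x}`, `∑ aₙ xⁿ ↦ ∑ aₙ xⁿ`. -/
def baseChange (b : ℕ+) : DiffPoly d →+* DiffPoly (db b) :=
  DiffPoly.map (incl b) (db_incl b)

end FormalLaurent

end

/-!
# Linear factorisation of differential polynomials over `ℂ((t))`

The proof is by induction on the degree, in the ring `A = ℂ((t)){x, t d/dt}`. An affine change of
variables is an endomorphism of `A` that ramifies the coefficients, `t ↦ tᵇ`, and sends `x` to an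
element of degree at most one. Such maps compose and take products of factors of degree at most
one to products of the same kind, so it suffices to show that a monic `f` of degree `n ≥ 2` becomes a
product of two factors of smaller degree after an affine change of variables
(`exists_isAffine_eq_mul`).

By a translation `x ↦ x - a` the term of degree `n - 1` can be removed, and by a ramification the
slopes of the Newton polygon can be made integral. Let `k ≥ 0` be the least integer such that, in
terms of `X = tᵏ x`, the differential polynomial `tᵏⁿ f` has coefficients in `ℂ⟦t⟧`, and let `p` be
its reduction modulo `t`, an ordinary monic polynomial over `ℂ`. Hensel's lemma
(`exists_eq_mul_of_red_eq_mul`) lifts a factorisation `p = q r`: the correction of order `tᵐ` is the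
solution of `a r + qₘ c = e`, where `qₘ` is the reduction of the conjugate of the first factor by
`tᵐ`.
* If `k > 0`, then `qₘ = q`, so that `q` and `r` only have to be coprime. Such a factorisation
  exists since `p` is not `Xⁿ` and has no term of degree `n - 1`, hence has two different roots.
* If `k = 0` (the regular singular case), then `qₘ(X) = q(X + m)`. With `r = X - α`, where `α` is a
  root of `p` of maximal real part, this is coprime to `r` for every `m ≥ 1`.

Finally the commutation rule forces an affine change of variables with ramification `t ↦ tᵇ` to be
of the form `x ↦ x / b + β`, so that undoing it in `K_b{x}` gives the factorisation of `f` over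
`K_b`.
-/

/-! ### Coefficients, degrees and the universal property of differential polynomials -/

namespace DiffPoly

section General

variable {R : Type*} [CommRing R] {d : Der R}

/-- The coefficient of `xⁱ`, coefficients being written on the left, as an additive map. -/
noncomputable def coeff (i : ℕ) : DiffPoly d →+ R :=
  (Polynomial.lcoeff R i).toAddMonoidHom.comp (ofPoly d).symm.toAddMonoidHom

theorem coeff_ofPoly (i : ℕ) (p : R[X]) : coeff i (ofPoly d p) = p.coeff i := rfl

theorem coeff_symm (i : ℕ) (f : DiffPoly d) : ((ofPoly d).symm f).coeff i = coeff i f := rfl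

theorem ext_coeff {f g : DiffPoly d} (h : ∀ i, coeff i f = coeff i g) : f = g :=
  (ofPoly d).symm.injective (Polynomial.ext h)

theorem coeff_const_mul (i : ℕ) (a : R) (f : DiffPoly d) :
    coeff i (const d a * f) = a * coeff i f := by
  change (leftMul d (C a) ((ofPoly d).symm f)).coeff i = a * ((ofPoly d).symm f).coeff i
  rw [← monomial_zero_left, leftMul_monomial]
  simp

theorem var_mul (f : DiffPoly d) : var d * f = ofPoly d (varMul d ((ofPoly d).symm f)) := by
  change leftMul d X ((ofPoly d).symm f) = varMul d ((ofPoly d).symm f)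
  rw [← monomial_one_one_eq_X, leftMul_monomial]
  simp

theorem coeff_zero_var_mul (f : DiffPoly d) : coeff 0 (var d * f) = d (coeff 0 f) := by
  rw [var_mul, coeff_ofPoly, ← coeff_symm]
  generalize (ofPoly d).symm f = p
  induction p using Polynomial.induction_on' with
  | add p q hp hq => simp only [map_add, Polynomial.coeff_add, hp, hq]
  | monomial n a =>
    rw [varMul_monomial]
    rcases n with _ | n <;> simp [coeff_monomial]

theorem coeff_succ_var_mul (i : ℕ) (f : DiffPoly d) :
    coeff (i + 1) (var d * f) = coeff i f + d (coeff (i + 1) f) := by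
  rw [var_mul, coeff_ofPoly, ← coeff_symm, ← coeff_symm]
  generalize (ofPoly d).symm f = p
  induction p using Polynomial.induction_on' with
  | add p q hp hq => simp only [map_add, Polynomial.coeff_add, hp, hq]; abel
  | monomial n a =>
    rw [varMul_monomial]
    simp only [Polynomial.coeff_add, coeff_monomial, add_left_inj]
    congr 1
    split_ifs <;> simp

theorem coeff_const_mul_var_pow (i n : ℕ) (a : R) :
    coeff i (const d a * var d ^ n) = if n = i then a else 0 := by
  rw [const_mul_var_pow, coeff_ofPoly, coeff_monomial]

theorem coeff_var_pow (i n : ℕ) : coeff i (var d ^ n) = if n = i then 1 else 0 := by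
  simpa using coeff_const_mul_var_pow (d := d) i n 1

theorem der_one (d : Der R) : d 1 = 0 := d.map_one_eq_zero

/-- A differential polynomial is the sum of its terms. -/
theorem eq_sum {f : DiffPoly d} {n : ℕ} (h : ∀ i, n ≤ i → coeff i f = 0) :
    f = ∑ i ∈ Finset.range n, const d (coeff i f) * var d ^ i := by
  refine ext_coeff fun j => ?_
  simp only [map_sum, coeff_const_mul_var_pow, Finset.sum_ite_eq', Finset.mem_range]
  split_ifs with hj
  · rfl
  · exact h j (not_lt.mp hj)

theorem exists_bound (f : DiffPoly d) : ∃ n, ∀ i, n ≤ i → coeff i f = 0 :=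
  ⟨((ofPoly d).symm f).natDegree + 1, fun _ hi => coeff_eq_zero_of_natDegree_lt hi⟩

/-- Additive maps out of `R{x, d}` are determined by their values on the terms `a xⁱ`. -/
theorem addHom_ext {M : Type*} [AddCommMonoid M] {F G : DiffPoly d →+ M}
    (h : ∀ a i, F (const d a * var d ^ i) = G (const d a * var d ^ i)) : F = G := by
  ext f
  obtain ⟨n, hn⟩ := exists_bound f
  rw [eq_sum hn, map_sum, map_sum]
  exact Finset.sum_congr rfl fun i _ => h _ i

theorem ringHom_ext {S : Type*} [Ring S] {F G : DiffPoly d →+* S}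
    (hc : ∀ a, F (const d a) = G (const d a)) (hv : F (var d) = G (var d)) : F = G := by
  have h : F.toAddMonoidHom = G.toAddMonoidHom := addHom_ext fun a i => by
    change F _ = G _
    simp only [map_mul, map_pow, hc, hv]
  ext f
  exact DFunLike.congr_fun h f

/-- The universal property of `R{x, d}`: a ring homomorphism `φ : R → S` and an element `y` of `S`
that satisfies the commutation rule of `x` define a ring homomorphism `R{x, d} → S`. -/
noncomputable def lift {S : Type*} [Ring S] (φ : R →+* S) (y : S)
    (h : ∀ a, y * φ a = φ a * y + φ (d a)) : DiffPoly d →+* S where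
  toFun f := ((ofPoly d).symm f).eval₂ φ y
  map_one' := eval₂_one φ y
  map_zero' := eval₂_zero φ y
  map_add' f g := eval₂_add φ y
  map_mul' f g := by
    have hs : ∀ (a : R) (g : R[X]), (a • g).eval₂ φ y = φ a * g.eval₂ φ y := by
      intro a g
      induction g using Polynomial.induction_on' with
      | add p q hp hq => simp only [smul_add, eval₂_add, hp, hq, mul_add]
      | monomial n b => simp [smul_monomial, eval₂_monomial, mul_assoc]
    have hv : ∀ g : R[X], (varMul d g).eval₂ φ y = y * g.eval₂ φ y := by
      intro g
      induction g using Polynomial.induction_on' with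
      | add p q hp hq => simp only [map_add, eval₂_add, hp, hq, mul_add]
      | monomial n b =>
        simp only [varMul_monomial, eval₂_add, eval₂_monomial, ← mul_assoc, h, add_mul, pow_succ']
    have hp : ∀ (n : ℕ) (g : R[X]), ((varMul d ^ n) g).eval₂ φ y = y ^ n * g.eval₂ φ y := by
      intro n g
      induction n with
      | zero => simp
      | succ n ih => rw [pow_succ', end_mul_apply, hv, ih, pow_succ', mul_assoc]
    change (leftMul d f g).eval₂ φ y = Polynomial.eval₂ φ y f * Polynomial.eval₂ φ y g
    generalize (show R[X] from g) = q
    generalize (show R[X] from f) = p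
    induction p using Polynomial.induction_on' with
    | add p q hp hq => simp only [map_add, eval₂_add, end_add_apply, hp, hq, add_mul]
    | monomial n b => rw [leftMul_monomial, hs, hp, eval₂_monomial, mul_assoc]

theorem lift_const {S : Type*} [Ring S] (φ : R →+* S) (y : S)
    (h : ∀ a, y * φ a = φ a * y + φ (d a)) (a : R) : lift φ y h (const d a) = φ a :=
  eval₂_C φ y

theorem lift_var {S : Type*} [Ring S] (φ : R →+* S) (y : S)
    (h : ∀ a, y * φ a = φ a * y + φ (d a)) : lift φ y h (var d) = y :=
  eval₂_X φ y

/-- The differential polynomials of degree less than `n`. -/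
noncomputable def degLT (d : Der R) (n : ℕ) : AddSubgroup (DiffPoly d) where
  carrier := {f | ∀ i, n ≤ i → coeff i f = 0}
  zero_mem' := fun i _ => map_zero (coeff i)
  add_mem' hf hg i hi := by rw [map_add, hf i hi, hg i hi, add_zero]
  neg_mem' hf i hi := by rw [map_neg, hf i hi, neg_zero]

theorem degLT_mono {m n : ℕ} (h : m ≤ n) : degLT d m ≤ degLT d n :=
  fun _ hf i hi => hf i (h.trans hi)

theorem const_mul_mem_degLT {n : ℕ} {f : DiffPoly d} (a : R) (hf : f ∈ degLT d n) :
    const d a * f ∈ degLT d n := fun i hi => by rw [coeff_const_mul, hf i hi, mul_zero]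

theorem var_mul_mem_degLT {n : ℕ} {f : DiffPoly d} (hf : f ∈ degLT d n) :
    var d * f ∈ degLT d (n + 1) := by
  rintro (_ | i) hi
  · omega
  · rw [coeff_succ_var_mul, hf i (by omega), hf (i + 1) (by omega), map_zero, add_zero]

theorem var_pow_mul_mem_degLT {n : ℕ} {f : DiffPoly d} (hf : f ∈ degLT d n) (m : ℕ) :
    var d ^ m * f ∈ degLT d (n + m) := by
  induction m with
  | zero => simpa using hf
  | succ m ih =>
    rw [pow_succ', mul_assoc]
    exact var_mul_mem_degLT ih

theorem mul_mem_degLT {m n : ℕ} {f g : DiffPoly d} (hf : f ∈ degLT d m)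
    (hg : g ∈ degLT d (n + 1)) : f * g ∈ degLT d (m + n) := by
  rw [eq_sum hf, Finset.sum_mul]
  refine sum_mem fun i hi => ?_
  rw [mul_assoc]
  refine const_mul_mem_degLT _ (degLT_mono ?_ (var_pow_mul_mem_degLT hg i))
  have := Finset.mem_range.mp hi
  omega

/-- `f` is monic of degree `n`. -/
noncomputable def IsMonicOfDeg (f : DiffPoly d) (n : ℕ) : Prop :=
  coeff n f = 1 ∧ f ∈ degLT d (n + 1)

theorem isMonicOfDeg_one : IsMonicOfDeg (1 : DiffPoly d) 0 := by
  refine ⟨by simpa using coeff_var_pow (d := d) 0 0, fun i hi => ?_⟩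
  have := coeff_var_pow (d := d) i 0
  rwa [pow_zero, if_neg (by omega)] at this

theorem IsMonicOfDeg.add {f g : DiffPoly d} {n : ℕ} (hf : IsMonicOfDeg f n)
    (hg : g ∈ degLT d n) : IsMonicOfDeg (f + g) n :=
  ⟨by rw [map_add, hf.1, hg n le_rfl, add_zero],
    add_mem hf.2 (degLT_mono (Nat.le_succ n) hg)⟩

theorem IsMonicOfDeg.sub_mem {f g : DiffPoly d} {n : ℕ} (hf : IsMonicOfDeg f n)
    (hg : IsMonicOfDeg g n) : f - g ∈ degLT d n := by
  intro i hi
  rcases hi.eq_or_lt with rfl | hi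
  · rw [map_sub, hf.1, hg.1, sub_self]
  · exact _root_.sub_mem hf.2 hg.2 i hi

theorem IsMonicOfDeg.var_mul {f : DiffPoly d} {n : ℕ} (hf : IsMonicOfDeg f n) :
    IsMonicOfDeg (var d * f) (n + 1) :=
  ⟨by rw [coeff_succ_var_mul, hf.1, hf.2 (n + 1) le_rfl, map_zero, add_zero],
    var_mul_mem_degLT hf.2⟩

theorem isMonicOfDeg_var_pow (n : ℕ) : IsMonicOfDeg (var d ^ n) n := by
  induction n with
  | zero => exact isMonicOfDeg_one
  | succ n ih => rw [pow_succ']; exact ih.var_mul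

theorem IsMonicOfDeg.mul {f g : DiffPoly d} {m n : ℕ} (hf : IsMonicOfDeg f m)
    (hg : IsMonicOfDeg g n) : IsMonicOfDeg (f * g) (m + n) := by
  have h : ∀ m, IsMonicOfDeg (var d ^ m * g) (m + n) := by
    intro m
    induction m with
    | zero => simpa using hg
    | succ m ih =>
      rw [pow_succ', mul_assoc, Nat.succ_add]
      exact ih.var_mul
  have h2 : f * g = var d ^ m * g + (f - var d ^ m) * g := by rw [← add_mul]; congr 1; abel
  rw [h2]
  exact (h m).add (mul_mem_degLT (hf.sub_mem (isMonicOfDeg_var_pow m)) hg.2)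

theorem const_mem_degLT (a : R) : const d a ∈ degLT d 1 := by
  simpa using const_mul_mem_degLT a (isMonicOfDeg_one (d := d)).2

theorem isMonicOfDeg_var_sub_const (a : R) : IsMonicOfDeg (var d - const d a) 1 := by
  rw [sub_eq_add_neg]
  exact (by simpa using isMonicOfDeg_var_pow (d := d) 1 : IsMonicOfDeg (var d) 1).add
    (neg_mem (const_mem_degLT a))

theorem isMonicOfDeg_prod (L : List R) :
    IsMonicOfDeg (L.map fun a => var d - const d a).prod L.length := by
  induction L with
  | nil => exact isMonicOfDeg_one
  | cons a L ih =>
    rw [List.map_cons, List.prod_cons, List.length_cons, add_comm]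
    exact (isMonicOfDeg_var_sub_const a).mul ih

/-- A homomorphism that sends coefficients to coefficients and `x` to an element of degree at most
one does not increase the degree. -/
theorem map_mem_degLT {S : Type*} [CommRing S] {d' : Der S} {Φ : DiffPoly d →+* DiffPoly d'}
    {φ : R →+* S} (hc : ∀ a, Φ (const d a) = const d' (φ a)) (hv : Φ (var d) ∈ degLT d' 2)
    {n : ℕ} {f : DiffPoly d} (hf : f ∈ degLT d n) : Φ f ∈ degLT d' n := by
  have h : ∀ i, Φ (var d) ^ i ∈ degLT d' (i + 1) := by
    intro i
    induction i with
    | zero => exact isMonicOfDeg_one.2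
    | succ i ih =>
      rw [pow_succ]
      exact mul_mem_degLT ih hv
  rw [eq_sum hf, map_sum]
  refine sum_mem fun i hi => ?_
  rw [map_mul, hc, map_pow]
  exact const_mul_mem_degLT _ (degLT_mono (Finset.mem_range.mp hi) (h i))

/-! ### Products of differential polynomials of degree at most one -/

/-- The differential polynomials that are products of elements `a x + b` (where `a = 0` is
allowed). -/
noncomputable def linProd (d : Der R) : Submonoid (DiffPoly d) :=
  Submonoid.closure {f | ∃ a b, f = const d a * var d + const d b}

theorem linear_mem_linProd (a b : R) : const d a * var d + const d b ∈ linProd d :=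
  Submonoid.subset_closure ⟨a, b, rfl⟩

theorem const_mem_linProd (a : R) : const d a ∈ linProd d := by
  simpa using linear_mem_linProd (d := d) 0 a

theorem mem_linProd_of_degLT {f : DiffPoly d} (hf : f ∈ degLT d 2) : f ∈ linProd d := by
  rw [eq_sum hf, Finset.sum_range_succ, Finset.sum_range_one, add_comm]
  simpa using linear_mem_linProd (d := d) (coeff 1 f) (coeff 0 f)

theorem linear_mem_degLT (a b : R) : const d a * var d + const d b ∈ degLT d 2 :=
  add_mem (const_mul_mem_degLT _ (by simpa using (isMonicOfDeg_var_pow (d := d) 1).2))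
    (degLT_mono one_le_two (const_mem_degLT b))

theorem map_mem_linProd {S : Type*} [CommRing S] {d' : Der S} {Φ : DiffPoly d →+* DiffPoly d'}
    {φ : R →+* S} (hc : ∀ a, Φ (const d a) = const d' (φ a)) (hv : Φ (var d) ∈ degLT d' 2)
    {f : DiffPoly d} (hf : f ∈ linProd d) : Φ f ∈ linProd d' := by
  induction hf using Submonoid.closure_induction with
  | mem f h =>
    obtain ⟨a, b, rfl⟩ := h
    exact mem_linProd_of_degLT (map_mem_degLT hc hv (linear_mem_degLT a b))
  | one => rw [map_one]; exact one_mem _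
  | mul f g _ _ hf hg => rw [map_mul]; exact mul_mem hf hg

end General

section Field

variable {F : Type*} [Field F] {d : Der F}

/-- Constants can be moved to the left of a product of factors `x - Λ`, at the price of changing
the `Λ`: `(x - Λ) c = c (x - (Λ - d c / c))`. -/
theorem prod_mul_const {c : F} (hc : c ≠ 0) (L : List F) :
    ∃ M : List F, (L.map fun a => var d - const d a).prod * const d c
      = const d c * (M.map fun a => var d - const d a).prod := by
  induction L with
  | nil => exact ⟨[], by simp⟩
  | cons a L ih =>
    obtain ⟨M, hM⟩ := ih
    refine ⟨(a - d c / c) :: M, ?_⟩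
    simp only [List.map_cons, List.prod_cons]
    rw [mul_assoc, hM, ← mul_assoc, ← mul_assoc]
    congr 1
    have h : d c = c * (d c / c) := by field_simp
    rw [sub_mul, var_mul_const, mul_sub, map_sub, mul_sub, ← map_mul, ← map_mul, ← map_mul, ← h,
      mul_comm a c]
    abel

/-- A product of factors of degree at most one is a constant times a product of factors
`x - Λ`. -/
theorem exists_const_mul_prod {f : DiffPoly d} (hf : f ∈ linProd d) :
    ∃ (a : F) (L : List F), f = const d a * (L.map fun a => var d - const d a).prod := by
  induction hf using Submonoid.closure_induction with
  | mem f h =>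
    obtain ⟨a, b, rfl⟩ := h
    by_cases ha : a = 0
    · exact ⟨b, [], by simp [ha]⟩
    · refine ⟨a, [-(b / a)], ?_⟩
      have h : const d b = const d a * const d (b / a) := by
        rw [← map_mul]
        congr 1
        field_simp
      simp [mul_add, h]
  | one => exact ⟨1, [], by simp⟩
  | mul f g _ _ hf hg =>
    obtain ⟨a, L, rfl⟩ := hf
    obtain ⟨b, M, rfl⟩ := hg
    by_cases hb : b = 0
    · exact ⟨0, [], by simp [hb]⟩
    · obtain ⟨L', hL'⟩ := prod_mul_const (d := d) hb L
      refine ⟨a * b, L' ++ M, ?_⟩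
      rw [List.map_append, List.prod_append, map_mul, mul_assoc, ← mul_assoc _ (const d b), hL']
      simp only [mul_assoc]

end Field

end DiffPoly

/-! ### Hensel's lemma for differential polynomials over `ℂ⟦s⟧` -/

namespace DiffPoly

/-- The derivation `sᵏ · s d/ds` of `ℂ⟦s⟧`. -/
noncomputable def pEuler (k : ℕ) : Der (PowerSeries ℂ) :=
  Der.ofAddHom ((AddMonoidHom.mulLeft (PowerSeries.X ^ (k + 1) : PowerSeries ℂ)).comp
    (PowerSeries.derivative ℂ).toLinearMap.toAddMonoidHom) fun a b => by
      change PowerSeries.X ^ (k + 1) * PowerSeries.derivative ℂ (a * b)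
        = a * (PowerSeries.X ^ (k + 1) * PowerSeries.derivative ℂ b)
          + b * (PowerSeries.X ^ (k + 1) * PowerSeries.derivative ℂ a)
      rw [Derivation.leibniz, smul_eq_mul, smul_eq_mul]
      ring

theorem pEuler_apply (k : ℕ) (a : PowerSeries ℂ) :
    pEuler k a = PowerSeries.X ^ (k + 1) * PowerSeries.derivative ℂ a := rfl

theorem constantCoeff_pEuler (k : ℕ) (a : PowerSeries ℂ) :
    PowerSeries.constantCoeff (pEuler k a) = 0 := by
  simp [pEuler_apply, pow_succ]

theorem pEuler_X_pow (k m : ℕ) : pEuler k (PowerSeries.X ^ m)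
    = PowerSeries.X ^ m * ((m : PowerSeries ℂ) * PowerSeries.X ^ k) := by
  rw [pEuler_apply, Derivation.leibniz_pow, PowerSeries.derivative_X]
  rcases m with _ | m
  · simp
  · simp only [smul_eq_mul, nsmul_eq_mul, Nat.add_sub_cancel]
    ring

variable {k : ℕ}

/-- Reduction modulo `s`. As the derivation is zero modulo `s`, its target is the commutative ring
of polynomials. -/
noncomputable def red (k : ℕ) : DiffPoly (pEuler k) →+* ℂ[X] :=
  lift (C.comp PowerSeries.constantCoeff) X fun a => by
    simp [constantCoeff_pEuler, X_mul_C]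

theorem red_const (a : PowerSeries ℂ) :
    red k (const _ a) = C (PowerSeries.constantCoeff a) := lift_const _ _ _ _

theorem red_var : red k (var _) = X := lift_var _ _ _

theorem coeff_red (f : DiffPoly (pEuler k)) (i : ℕ) :
    (red k f).coeff i = PowerSeries.constantCoeff (coeff i f) := by
  have h : (Polynomial.lcoeff ℂ i).toAddMonoidHom.comp (red k).toAddMonoidHom
      = (PowerSeries.constantCoeff (R := ℂ)).toAddMonoidHom.comp (coeff i) :=
    addHom_ext fun a n => by
      change (red k (const _ a * var _ ^ n)).coeff i
        = PowerSeries.constantCoeff (coeff i (const _ a * var _ ^ n))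
      rw [map_mul, map_pow, red_const, red_var, coeff_C_mul_X_pow, coeff_const_mul_var_pow]
      by_cases hi : n = i
      · simp [hi]
      · simp [hi, Ne.symm hi]
  exact DFunLike.congr_fun h f

/-- The differential polynomial with constant coefficients that has a given reduction. -/
noncomputable def ofRed (k : ℕ) (p : ℂ[X]) : DiffPoly (pEuler k) :=
  ofPoly _ (p.map PowerSeries.C)

theorem coeff_ofRed (p : ℂ[X]) (i : ℕ) : coeff i (ofRed k p) = PowerSeries.C (p.coeff i) := by
  rw [ofRed, coeff_ofPoly, coeff_map]

theorem red_ofRed (p : ℂ[X]) : red k (ofRed k p) = p := by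
  ext i
  simp [coeff_red, coeff_ofRed]

theorem ofRed_mem_degLT {p : ℂ[X]} {n : ℕ} (hp : p.degree < n) :
    ofRed k p ∈ degLT _ n := fun i hi => by
  rw [coeff_ofRed, coeff_eq_zero_of_degree_lt (hp.trans_le (by exact_mod_cast hi)), map_zero]

theorem isMonicOfDeg_ofRed {p : ℂ[X]} (hp : p.Monic) :
    IsMonicOfDeg (ofRed k p) p.natDegree := by
  refine ⟨by rw [coeff_ofRed, hp.coeff_natDegree, map_one], ofRed_mem_degLT ?_⟩
  exact degree_le_natDegree.trans_lt (by exact_mod_cast Nat.lt_succ_self _)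

/-- The automorphism `x ↦ x + m sᵏ`, that is, the conjugation `f ↦ s⁻ᵐ f sᵐ`. -/
noncomputable def shift (k m : ℕ) : DiffPoly (pEuler k) →+* DiffPoly (pEuler k) :=
  lift (const _) (var _ + const _ ((m : PowerSeries ℂ) * PowerSeries.X ^ k)) fun a => by
    rw [add_mul, var_mul_const, mul_add, ← map_mul, ← map_mul, mul_comm a]
    abel

theorem mul_const_X_pow (m : ℕ) (f : DiffPoly (pEuler k)) :
    f * const _ (PowerSeries.X ^ m) = const _ (PowerSeries.X ^ m) * shift k m f := by
  have h : (AddMonoidHom.mulRight (const (pEuler k) (PowerSeries.X ^ m)))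
      = (AddMonoidHom.mulLeft (const (pEuler k) (PowerSeries.X ^ m))).comp
        (shift k m).toAddMonoidHom :=
    addHom_ext fun a i => by
      change const _ a * var _ ^ i * const _ (PowerSeries.X ^ m)
        = const _ (PowerSeries.X ^ m) * shift k m (const _ a * var _ ^ i)
      have hv : SemiconjBy (const (pEuler k) (PowerSeries.X ^ m))
          (var _ + const _ ((m : PowerSeries ℂ) * PowerSeries.X ^ k)) (var _) := by
        change _ * _ = _ * _
        rw [var_mul_const, pEuler_X_pow, mul_add, ← map_mul]
      rw [map_mul, map_pow (shift k m), shift, lift_const, lift_var, mul_assoc, ← (hv.pow_right i).eq,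
        ← mul_assoc, ← mul_assoc, ← map_mul, ← map_mul, mul_comm a]
  exact DFunLike.congr_fun h f

theorem red_shift (m : ℕ) (f : DiffPoly (pEuler k)) :
    red k (shift k m f) = (red k f).comp (X + C ((m : ℂ) * 0 ^ k)) := by
  have h : (red k).comp (shift k m)
      = (compRingHom (X + C ((m : ℂ) * 0 ^ k))).comp (red k) := by
    refine ringHom_ext (fun a => ?_) ?_
    · simp [shift, lift_const, red_const]
    · simp [shift, lift_var, red_const, red_var]
  exact RingHom.congr_fun h f

theorem exists_eq_const_mul {R : Type*} [CommRing R] {d : Der R} {f : DiffPoly d} {c : R} {n : ℕ}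
    (hf : f ∈ degLT d n) (h : ∀ i, c ∣ coeff i f) : ∃ g ∈ degLT d n, f = const d c * g := by
  choose b hb using h
  refine ⟨∑ i ∈ Finset.range n, const d (b i) * var d ^ i, sum_mem fun i hi => ?_, ?_⟩
  · exact const_mul_mem_degLT _
      (degLT_mono (Finset.mem_range.mp hi) (isMonicOfDeg_var_pow i).2)
  · rw [Finset.mul_sum]
    conv_lhs => rw [eq_sum hf]
    refine Finset.sum_congr rfl fun i _ => ?_
    rw [← mul_assoc, ← map_mul, ← hb]

/-- Solving `a r + q c = e` with bounds on the degrees, for coprime monic `q` and `r`. -/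
theorem exists_mul_add_mul_eq {q r e : ℂ[X]} (hq : q.Monic) (hr : r.Monic) (h : IsCoprime q r)
    (he : e.degree < (q.natDegree + r.natDegree : ℕ)) :
    ∃ a c : ℂ[X], a.degree < q.natDegree ∧ c.degree < r.natDegree ∧ a * r + q * c = e := by
  obtain ⟨u, v, huv⟩ := h
  have hc : ((e * u) %ₘ r).degree < r.natDegree := by
    rw [← degree_eq_natDegree hr.ne_zero]
    exact degree_modByMonic_lt _ hr
  have heq : (e * v + q * ((e * u) /ₘ r)) * r + q * ((e * u) %ₘ r) = e := by
    linear_combination q * modByMonic_add_div (e * u) r + e * huv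
  refine ⟨_, _, ?_, hc, heq⟩
  have hlt : (((e * v + q * ((e * u) /ₘ r)) * r).degree) < (q.natDegree + r.natDegree : ℕ) := by
    rw [← eq_sub_iff_add_eq] at heq
    rw [heq]
    refine (degree_sub_le _ _).trans_lt (max_lt he ?_)
    rw [degree_mul, degree_eq_natDegree hq.ne_zero, Nat.cast_add]
    exact WithBot.add_lt_add_left (by simp) hc
  rw [degree_mul, degree_eq_natDegree hr.ne_zero, Nat.cast_add] at hlt
  exact lt_of_add_lt_add_right hlt

/-- One step of the approximation in Hensel's lemma. -/
theorem hensel_step {P : DiffPoly (pEuler k)} {q r : ℂ[X]} (hq : q.Monic) (hr : r.Monic)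
    (hP : IsMonicOfDeg P (q.natDegree + r.natDegree))
    {m : ℕ} (hm : 1 ≤ m) (hqr : IsCoprime (q.comp (X + C ((m : ℂ) * 0 ^ k))) r)
    {Q R : DiffPoly (pEuler k)} (hQ : IsMonicOfDeg Q q.natDegree)
    (hR : IsMonicOfDeg R r.natDegree) (hQq : red k Q = q) (hRr : red k R = r)
    (h : ∀ i, PowerSeries.X ^ m ∣ coeff i (P - Q * R)) :
    ∃ A ∈ degLT (pEuler k) q.natDegree, ∃ B ∈ degLT (pEuler k) r.natDegree,
      ∀ i, PowerSeries.X ^ (m + 1) ∣ coeff i (P - (Q + const _ (PowerSeries.X ^ m) * A)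
        * (R + const _ (PowerSeries.X ^ m) * B)) := by
  obtain ⟨E, hE, hPE⟩ := exists_eq_const_mul (hP.sub_mem (hQ.mul hR)) h
  have hq' : (q.comp (X + C ((m : ℂ) * 0 ^ k))).Monic := hq.comp_X_add_C _
  have hdeg : (q.comp (X + C ((m : ℂ) * 0 ^ k))).natDegree = q.natDegree := by
    rw [natDegree_comp, natDegree_X_add_C, mul_one]
  have hEdeg : (red k E).degree < (q.natDegree + r.natDegree : ℕ) := by
    rw [degree_lt_iff_coeff_zero]
    intro i hi
    rw [coeff_red, hE i hi, map_zero]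
  obtain ⟨a, c, ha, hc, hac⟩ := exists_mul_add_mul_eq hq' hr hqr (by rwa [hdeg])
  rw [hdeg] at ha
  refine ⟨ofRed k a, ofRed_mem_degLT ha, ofRed k c, ofRed_mem_degLT hc, fun i => ?_⟩
  have key : P - (Q + const _ (PowerSeries.X ^ m) * ofRed k a)
        * (R + const _ (PowerSeries.X ^ m) * ofRed k c)
      = const _ (PowerSeries.X ^ m) * (E - ofRed k a * R - shift k m Q * ofRed k c
        - ofRed k a * (const _ (PowerSeries.X ^ m) * ofRed k c)) := by
    have h1 : P = Q * R + const _ (PowerSeries.X ^ m) * E := by rw [← hPE]; abel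
    rw [h1]
    simp only [mul_sub, add_mul, mul_add]
    rw [← mul_assoc Q, mul_const_X_pow]
    simp only [mul_assoc]
    abel
  -- The term quadratic in the corrections vanishes modulo `s` because `m ≥ 1`.
  rw [key, coeff_const_mul, pow_succ]
  refine mul_dvd_mul_left _ ?_
  rw [PowerSeries.X_dvd_iff, ← coeff_red]
  simp only [map_sub, map_mul, red_ofRed, red_shift, hQq, hRr, red_const]
  have hz : PowerSeries.constantCoeff (PowerSeries.X ^ m : PowerSeries ℂ) = 0 := by
    rw [map_pow, PowerSeries.constantCoeff_X, zero_pow (by omega)]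
  rw [hz, map_zero, zero_mul, mul_zero, sub_zero, ← hac]
  simp

/-- Sequences of differential polynomials of bounded degree that are Cauchy for the `s`-adic
topology converge. -/
theorem exists_limit {n : ℕ} (Q : ℕ → DiffPoly (pEuler k)) (hQ : ∀ m, Q m ∈ degLT _ n)
    (h : ∀ m i, PowerSeries.X ^ (m + 1) ∣ coeff i (Q (m + 1) - Q m)) :
    ∃ Q' ∈ degLT (pEuler k) n, ∀ m i, PowerSeries.X ^ (m + 1) ∣ coeff i (Q' - Q m) := by
  let c : ℕ → PowerSeries ℂ := fun i => PowerSeries.mk fun j => PowerSeries.coeff j (coeff i (Q j))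
  have hstab : ∀ i j m, j ≤ m →
      PowerSeries.coeff j (coeff i (Q m)) = PowerSeries.coeff j (coeff i (Q j)) := by
    intro i j m hjm
    induction m, hjm using Nat.le_induction with
    | base => rfl
    | succ m hjm ih =>
      have h1 := PowerSeries.X_pow_dvd_iff.mp (h m i) j (by omega)
      rw [map_sub, map_sub, sub_eq_zero] at h1
      rw [h1, ih]
  have hc : ∀ i, coeff i (∑ i ∈ Finset.range n, const (pEuler k) (c i) * var _ ^ i) = c i := by
    intro i
    simp only [map_sum, coeff_const_mul_var_pow, Finset.sum_ite_eq', Finset.mem_range]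
    split_ifs with hi
    · rfl
    · ext j
      simp [c, hQ j i (not_lt.mp hi)]
  refine ⟨∑ i ∈ Finset.range n, const _ (c i) * var _ ^ i, fun i hi => ?_, fun m i => ?_⟩
  · rw [hc]
    ext j
    simp [c, hQ j i hi]
  · rw [PowerSeries.X_pow_dvd_iff]
    intro j hj
    rw [map_sub, map_sub, hc, hstab i j m (by omega), sub_eq_zero]
    simp [c]

/-- Hensel's lemma: if the reduction of a monic `P` is the product of `q` and `r`, and `r` is
coprime to the conjugates of `q` under `sᵐ` for all `m ≥ 1`, then the factorisation lifts to `P`.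
For `k ≥ 1` the condition says that `q` and `r` are coprime, while for `k = 0` it is about the
translates of `q`. -/
theorem exists_eq_mul_of_red_eq_mul {P : DiffPoly (pEuler k)} {q r : ℂ[X]} (hq : q.Monic)
    (hr : r.Monic) (hP : IsMonicOfDeg P (q.natDegree + r.natDegree)) (hred : red k P = q * r)
    (hqr : ∀ m : ℕ, 1 ≤ m → IsCoprime (q.comp (X + C ((m : ℂ) * 0 ^ k))) r) :
    ∃ Q ∈ degLT (pEuler k) (q.natDegree + 1), ∃ R ∈ degLT (pEuler k) (r.natDegree + 1),
      P = Q * R := by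
  let Good : ℕ → DiffPoly (pEuler k) × DiffPoly (pEuler k) → Prop := fun m x =>
    IsMonicOfDeg x.1 q.natDegree ∧ IsMonicOfDeg x.2 r.natDegree ∧ red k x.1 = q ∧
      red k x.2 = r ∧ ∀ i, PowerSeries.X ^ (m + 1) ∣ coeff i (P - x.1 * x.2)
  have hstep : ∀ m x, Good m x → ∃ y, Good (m + 1) y ∧
      (∀ i, PowerSeries.X ^ (m + 1) ∣ coeff i (y.1 - x.1)) ∧
      ∀ i, PowerSeries.X ^ (m + 1) ∣ coeff i (y.2 - x.2) := by
    rintro m ⟨Q, R⟩ ⟨h1, h2, h3, h4, h5⟩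
    obtain ⟨A, hA, B, hB, hAB⟩ := hensel_step hq hr hP (Nat.le_add_left 1 m)
      (hqr (m + 1) (Nat.le_add_left 1 m)) h1 h2 h3 h4 h5
    have hz : red k (const _ (PowerSeries.X ^ (m + 1))) = 0 := by
      rw [red_const, map_pow, PowerSeries.constantCoeff_X, zero_pow (by omega), map_zero]
    refine ⟨(Q + const _ (PowerSeries.X ^ (m + 1)) * A, R + const _ (PowerSeries.X ^ (m + 1)) * B),
      ⟨h1.add (const_mul_mem_degLT _ hA), h2.add (const_mul_mem_degLT _ hB), ?_, ?_, hAB⟩,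
      ?_, ?_⟩
    · rw [map_add, map_mul, hz, zero_mul, add_zero, h3]
    · rw [map_add, map_mul, hz, zero_mul, add_zero, h4]
    · intro i
      rw [add_sub_cancel_left, coeff_const_mul]
      exact dvd_mul_right _ _
    · intro i
      rw [add_sub_cancel_left, coeff_const_mul]
      exact dvd_mul_right _ _
  have h0 : Good 0 (ofRed k q, ofRed k r) := by
    refine ⟨isMonicOfDeg_ofRed hq, isMonicOfDeg_ofRed hr, red_ofRed q, red_ofRed r,
      fun i => ?_⟩
    rw [zero_add, pow_one, PowerSeries.X_dvd_iff, ← coeff_red, map_sub, map_mul, red_ofRed,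
      red_ofRed, hred, sub_self, coeff_zero]
  choose! next hnext using hstep
  let u : ℕ → DiffPoly (pEuler k) × DiffPoly (pEuler k) := fun m =>
    Nat.rec (ofRed k q, ofRed k r) (fun m x => next m x) m
  have hu : ∀ m, Good m (u m) := by
    intro m
    induction m with
    | zero => exact h0
    | succ m ih => exact (hnext m _ ih).1
  obtain ⟨Q, hQ, hQu⟩ := exists_limit (fun m => (u m).1) (fun m => (hu m).1.2)
    (fun m => (hnext m _ (hu m)).2.1)
  obtain ⟨R, hR, hRu⟩ := exists_limit (fun m => (u m).2) (fun m => (hu m).2.1.2)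
    (fun m => (hnext m _ (hu m)).2.2)
  refine ⟨Q, hQ, R, hR, ?_⟩
  have hdvd : ∀ m i, PowerSeries.X ^ (m + 1) ∣ coeff i (P - Q * R) := by
    intro m i
    obtain ⟨A, -, hA⟩ := exists_eq_const_mul (sub_mem hQ (hu m).1.2) (hQu m)
    obtain ⟨B, -, hB⟩ := exists_eq_const_mul (sub_mem hR (hu m).2.1.2) (hRu m)
    have h1 : P - Q * R = (P - (u m).1 * (u m).2)
        - const _ (PowerSeries.X ^ (m + 1)) * (A * R + shift k (m + 1) (u m).1 * B) := by
      rw [mul_add, ← mul_assoc, ← hA, ← mul_assoc, ← mul_const_X_pow, mul_assoc, ← hB]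
      simp only [sub_mul, mul_sub]
      abel
    rw [h1, map_sub, coeff_const_mul]
    exact dvd_sub ((hu m).2.2.2.2 i) (dvd_mul_right _ _)
  rw [← sub_eq_zero]
  refine ext_coeff fun i => ?_
  ext j
  rw [map_zero, map_zero]
  exact PowerSeries.X_pow_dvd_iff.mp (hdvd j i) j (Nat.lt_succ_self j)

end DiffPoly

/-! ### Factorisations of the reduced polynomial -/

theorem isCoprime_X_sub_C_of_eval_ne_zero {q : ℂ[X]} {α : ℂ} (h : q.eval α ≠ 0) :
    IsCoprime q (X - C α) := by
  refine ((irreducible_X_sub_C α).coprime_iff_not_dvd.mpr fun hd => h ?_).symm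
  exact dvd_iff_isRoot.mp hd

/-- A root of maximal real part remains a root under no translation by a positive integer. -/
theorem exists_mul_X_sub_C_isCoprime_comp {p : ℂ[X]} (hp : p.Monic) (hn : p.natDegree ≠ 0) :
    ∃ (q : ℂ[X]) (α : ℂ), q.Monic ∧ p = q * (X - C α) ∧
      ∀ m : ℕ, 1 ≤ m → IsCoprime (q.comp (X + C (m : ℂ))) (X - C α) := by
  have hne : p.roots.toFinset.Nonempty := by
    obtain ⟨z, hz⟩ := Complex.exists_root (natDegree_pos_iff_degree_pos.mp (Nat.pos_of_ne_zero hn))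
    exact ⟨z, by simpa [hp.ne_zero] using hz⟩
  obtain ⟨α, hα, hmax⟩ := Finset.exists_max_image _ Complex.re hne
  simp only [Multiset.mem_toFinset, mem_roots hp.ne_zero] at hα hmax
  obtain ⟨q, hq⟩ := dvd_iff_isRoot.mpr hα
  rw [mul_comm] at hq
  refine ⟨q, α, (monic_X_sub_C α).of_mul_monic_right (hq ▸ hp), hq, fun m hm => ?_⟩
  refine isCoprime_X_sub_C_of_eval_ne_zero fun h0 => ?_
  have h1 : q.eval (α + m) = 0 := by simpa [eval_comp] using h0
  have h2 := hmax (α + m) (by rw [IsRoot.def, hq, eval_mul, h1, zero_mul])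
  have h3 : (1 : ℝ) ≤ m := by exact_mod_cast hm
  simp only [Complex.add_re, Complex.natCast_re] at h2
  linarith

/-- A monic polynomial of degree `n + 1` without term of degree `n`, other than `Xⁿ⁺¹`, is not a
power of some `X - α`, so the part belonging to one root can be split off. -/
theorem exists_isCoprime_mul {p : ℂ[X]} (hp : p.Monic) {n : ℕ} (hn : p.natDegree = n + 1)
    (h0 : p.coeff n = 0) (hX : p ≠ X ^ (n + 1)) :
    ∃ q r : ℂ[X], q.Monic ∧ r.Monic ∧ p = q * r ∧ IsCoprime q r ∧ q.natDegree ≠ 0 ∧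
      r.natDegree ≠ 0 := by
  obtain ⟨α, hα⟩ := Complex.exists_root
    (natDegree_pos_iff_degree_pos.mp (by omega : 0 < p.natDegree))
  obtain ⟨r, hr, hdvd⟩ := exists_eq_pow_rootMultiplicity_mul_and_not_dvd p hp.ne_zero α
  have hm : 0 < p.rootMultiplicity α := (rootMultiplicity_pos hp.ne_zero).mpr hα
  generalize p.rootMultiplicity α = m at hr hm
  have hq : ((X - C α) ^ m).Monic := (monic_X_sub_C α).pow m
  have hrm : r.Monic := hq.of_mul_monic_left (hr ▸ hp)
  have hqd : ((X - C α) ^ m).natDegree = m := by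
    rw [(monic_X_sub_C α).natDegree_pow, natDegree_X_sub_C, mul_one]
  refine ⟨_, r, hq, hrm, hr, ?_, by omega, fun hr0 => ?_⟩
  · exact ((irreducible_X_sub_C α).coprime_iff_not_dvd.mpr hdvd).pow_left
  · have hr1 : r = 1 := hrm.natDegree_eq_zero.mp hr0
    rw [hr1, mul_one] at hr
    have hmn : m = n + 1 := by rw [← hqd, ← hr, hn]
    have h1 : p.nextCoeff = 0 := by
      rw [nextCoeff_of_natDegree_pos (by omega), hn, Nat.add_sub_cancel, h0]
    rw [hr, (monic_X_sub_C α).nextCoeff_pow, nextCoeff_X_sub_C, nsmul_eq_mul, mul_neg,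
      neg_eq_zero, mul_eq_zero] at h1
    have hα0 : α = 0 := h1.resolve_left (by exact_mod_cast hm.ne')
    rw [hα0, C_0, sub_zero, hmn] at hr
    exact hX hr

/-! ### Factorisation of differential polynomials of integral slope -/

namespace FormalLaurent

open DiffPoly

theorem euler_single (n : ℤ) (c : ℂ) :
    euler (HahnSeries.single n c) = HahnSeries.single n (n * c) := by
  ext j
  rw [euler_coeff, HahnSeries.coeff_single, HahnSeries.coeff_single]
  split_ifs with h
  · rw [h]
  · rw [mul_zero]

theorem ofPowerSeries_pEuler (k : ℕ) (a : PowerSeries ℂ) :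
    HahnSeries.ofPowerSeries ℤ ℂ (pEuler k a)
      = HahnSeries.single (k : ℤ) 1 * euler (HahnSeries.ofPowerSeries ℤ ℂ a) := by
  have h : HahnSeries.ofPowerSeries ℤ ℂ (PowerSeries.X * PowerSeries.derivative ℂ a)
      = euler (HahnSeries.ofPowerSeries ℤ ℂ a) := by
    ext n
    rw [euler_coeff, PowerSeries.coeff_coe, PowerSeries.coeff_coe]
    split_ifs with hn
    · rw [mul_zero]
    · obtain ⟨n, rfl⟩ := Int.eq_ofNat_of_zero_le (not_lt.mp hn)
      rcases n with _ | n
      · simp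
      · rw [Int.natAbs_natCast, PowerSeries.coeff_succ_X_mul, PowerSeries.coeff_derivative]
        push_cast
        ring
  rw [pEuler_apply, pow_succ, mul_assoc, map_mul, h, HahnSeries.ofPowerSeries_X_pow]

/-- The homomorphism `ℂ⟦s⟧{X, sᵏ · s d/ds} → ℂ((s)){x, s d/ds}` with `X ↦ sᵏ x`. -/
noncomputable def scale (k : ℕ) : DiffPoly (pEuler k) →+* DiffPoly d :=
  lift ((const d).comp (HahnSeries.ofPowerSeries ℤ ℂ))
    (const d (HahnSeries.single (k : ℤ) 1) * var d) fun a => by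
      simp only [RingHom.comp_apply]
      rw [ofPowerSeries_pEuler, mul_assoc, var_mul_const, mul_add, ← mul_assoc, ← mul_assoc,
        ← map_mul, ← map_mul, ← map_mul, mul_comm (HahnSeries.single _ _)]
      rfl

theorem scale_const (k : ℕ) (a : PowerSeries ℂ) :
    scale k (const _ a) = const d (HahnSeries.ofPowerSeries ℤ ℂ a) := lift_const _ _ _ _

theorem scale_var (k : ℕ) :
    scale k (var _) = const d (HahnSeries.single (k : ℤ) 1) * var d := lift_var _ _ _

theorem scale_mem_degLT {k n : ℕ} {f : DiffPoly (pEuler k)} (hf : f ∈ degLT _ n) :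
    scale k f ∈ degLT d n := by
  refine map_mem_degLT (φ := HahnSeries.ofPowerSeries ℤ ℂ) (scale_const k) ?_ hf
  rw [scale_var]
  simpa using linear_mem_degLT (d := d) (HahnSeries.single (k : ℤ) 1) 0

/-- The differential polynomial `∏_{j < i} (X - j k sᵏ)`, which is `s^{k i} xⁱ` for
`X = sᵏ x`. -/
noncomputable def scaledPow (k : ℕ) : ℕ → DiffPoly (pEuler k)
  | 0 => 1
  | i + 1 => (var _ - const _ (((i * k : ℕ) : PowerSeries ℂ) * PowerSeries.X ^ k)) * scaledPow k i

theorem isMonicOfDeg_scaledPow (k i : ℕ) : IsMonicOfDeg (scaledPow k i) i := by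
  induction i with
  | zero => exact isMonicOfDeg_one
  | succ i ih =>
    rw [scaledPow, add_comm]
    exact (isMonicOfDeg_var_sub_const _).mul ih

theorem red_scaledPow (k i : ℕ) : red k (scaledPow k i) = X ^ i := by
  induction i with
  | zero => simp [scaledPow]
  | succ i ih =>
    have h : PowerSeries.constantCoeff (((i * k : ℕ) : PowerSeries ℂ) * PowerSeries.X ^ k) = 0 := by
      rcases k with _ | k <;> simp
    rw [scaledPow, map_mul, map_sub, red_var, red_const, h, map_zero, sub_zero, ih, pow_succ']

theorem scale_scaledPow (k i : ℕ) :
    scale k (scaledPow k i) = const d (HahnSeries.single ((k * i : ℕ) : ℤ) 1) * var d ^ i := by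
  induction i with
  | zero =>
    rw [scaledPow, map_one, pow_zero, mul_one, mul_zero, Nat.cast_zero, HahnSeries.single_zero_one,
      map_one]
  | succ i ih =>
    have h1 : d (HahnSeries.single ((k * i : ℕ) : ℤ) (1 : ℂ))
        = ((i * k : ℕ) : K) * HahnSeries.single ((k * i : ℕ) : ℤ) 1 := by
      rw [d, euler_single, ← map_natCast (HahnSeries.C : ℂ →+* K), HahnSeries.C_apply,
        HahnSeries.single_mul_single, zero_add]
      congr 1
      push_cast
      rw [mul_one, mul_one, mul_comm (k : ℂ)]
    have h2 : HahnSeries.single ((k * (i + 1) : ℕ) : ℤ) (1 : ℂ)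
        = HahnSeries.single (k : ℤ) 1 * HahnSeries.single ((k * i : ℕ) : ℤ) 1 := by
      rw [HahnSeries.single_mul_single, one_mul, ← Nat.cast_add, mul_add, mul_one, add_comm k]
    have h3 : HahnSeries.ofPowerSeries ℤ ℂ (((i * k : ℕ) : PowerSeries ℂ) * PowerSeries.X ^ k)
        = HahnSeries.single (k : ℤ) 1 * ((i * k : ℕ) : K) := by
      rw [map_mul, map_natCast, HahnSeries.ofPowerSeries_X_pow, mul_comm]
    rw [scaledPow, map_mul, ih, map_sub, scale_var, scale_const, h3, h2, map_mul, map_mul,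
      ← mul_sub, mul_assoc, mul_assoc, ← mul_assoc _ _ (var d ^ i)]
    congr 1
    rw [sub_mul, var_mul_const, h1, map_mul, add_sub_cancel_right, mul_assoc, ← pow_succ']

theorem exists_ofPowerSeries_eq (a : K) (h : ∀ j < (0 : ℤ), a.coeff j = 0) :
    ∃ c : PowerSeries ℂ, HahnSeries.ofPowerSeries ℤ ℂ c = a ∧
      PowerSeries.constantCoeff c = a.coeff 0 := by
  refine ⟨PowerSeries.mk fun n => a.coeff n, ?_, by simp⟩
  ext j
  rw [PowerSeries.coeff_coe]
  split_ifs with hj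
  · rw [h j hj]
  · obtain ⟨n, rfl⟩ := Int.eq_ofNat_of_zero_le (not_lt.mp hj)
    simp

/-- If the Newton polygon of a monic `f` lies above the line of slope `k`, then suitable
factorisations of the polynomial formed by the coefficients of `f` on this line lift to `f`. -/
theorem exists_eq_mul_of_slope {f : DiffPoly d} {n k : ℕ} (hf : IsMonicOfDeg f n)
    (hslope : ∀ i < n, ∀ j : ℤ, j < -((k * (n - i) : ℕ) : ℤ) → (coeff i f).coeff j = 0)
    {q r : ℂ[X]} (hq : q.Monic) (hr : r.Monic) (hdeg : q.natDegree + r.natDegree = n)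
    (hlead : ∀ i < n, (q * r).coeff i = (coeff i f).coeff (-((k * (n - i) : ℕ) : ℤ)))
    (hqr : ∀ m : ℕ, 1 ≤ m → IsCoprime (q.comp (X + C ((m : ℂ) * 0 ^ k))) r) :
    ∃ g ∈ degLT d (q.natDegree + 1), ∃ h ∈ degLT d (r.natDegree + 1), f = g * h := by
  have hc : ∀ i, ∃ c : PowerSeries ℂ, i < n → HahnSeries.ofPowerSeries ℤ ℂ c
      = HahnSeries.single ((k * (n - i) : ℕ) : ℤ) 1 * coeff i f ∧
        PowerSeries.constantCoeff c = (q * r).coeff i := by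
    intro i
    by_cases hi : i < n
    · obtain ⟨c, hc1, hc2⟩ := exists_ofPowerSeries_eq
        (HahnSeries.single ((k * (n - i) : ℕ) : ℤ) 1 * coeff i f) fun j hj => by
          rw [HahnSeries.coeff_single_mul, hslope i hi _ (by omega), mul_zero]
      refine ⟨c, fun _ => ⟨hc1, ?_⟩⟩
      rw [hc2, HahnSeries.coeff_single_mul, hlead i hi, zero_sub, one_mul]
    · exact ⟨0, fun h => absurd h hi⟩
  choose c hc using hc
  set P : DiffPoly (pEuler k) :=
    scaledPow k n + ∑ i ∈ Finset.range n, const _ (c i) * scaledPow k i with hPdef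
  have hP : IsMonicOfDeg P n := (isMonicOfDeg_scaledPow k n).add <| sum_mem fun i hi =>
    const_mul_mem_degLT _
      (degLT_mono (Finset.mem_range.mp hi) (isMonicOfDeg_scaledPow k i).2)
  have hqrm : (q * r).Monic := hq.mul hr
  have hqrd : (q * r).natDegree = n := by rw [hq.natDegree_mul hr, hdeg]
  have hred : red k P = q * r := by
    rw [hPdef, map_add, map_sum, red_scaledPow, hqrm.as_sum, hqrd]
    congr 1
    refine Finset.sum_congr rfl fun i hi => ?_
    rw [map_mul, red_const, red_scaledPow, (hc i (Finset.mem_range.mp hi)).2]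
  have hscale : scale k P = const d (HahnSeries.single ((k * n : ℕ) : ℤ) 1) * f := by
    have hfsum : f = var d ^ n + ∑ i ∈ Finset.range n, const d (coeff i f) * var d ^ i := by
      conv_lhs => rw [eq_sum hf.2, Finset.sum_range_succ, hf.1, map_one, one_mul, add_comm]
    conv_rhs => rw [hfsum]
    rw [hPdef, map_add, map_sum, scale_scaledPow, mul_add, Finset.mul_sum]
    congr 1
    refine Finset.sum_congr rfl fun i hi => ?_
    have hi' := Finset.mem_range.mp hi
    rw [map_mul, scale_const, scale_scaledPow, (hc i hi').1, ← mul_assoc, ← mul_assoc, ← map_mul,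
      ← map_mul, mul_right_comm, HahnSeries.single_mul_single, one_mul]
    have : ((k * (n - i) : ℕ) : ℤ) + ((k * i : ℕ) : ℤ) = ((k * n : ℕ) : ℤ) := by
      rw [← Nat.cast_add, ← mul_add, Nat.sub_add_cancel hi'.le]
    rw [this]
  obtain ⟨Q, hQ, R, hR, hPQR⟩ := exists_eq_mul_of_red_eq_mul hq hr (hdeg ▸ hP) hred hqr
  refine ⟨const d (HahnSeries.single (-((k * n : ℕ) : ℤ)) 1) * scale k Q,
    const_mul_mem_degLT _ (scale_mem_degLT hQ), scale k R, scale_mem_degLT hR, ?_⟩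
  rw [mul_assoc, ← map_mul, ← hPQR, hscale, ← mul_assoc, ← map_mul, HahnSeries.single_mul_single,
    neg_add_cancel, one_mul, HahnSeries.single_zero_one, map_one, one_mul]

end FormalLaurent

/-! ### Affine changes of variables -/

namespace FormalLaurent

open DiffPoly

theorem coeff_incl_mul (b : ℕ+) (a : K) (n : ℤ) : (incl b a).coeff ((b : ℤ) * n) = a.coeff n :=
  HahnSeries.embDomain_coeff (f := ⟨⟨AddMonoidHom.mulLeft (b : ℤ), _⟩, _⟩) (a := n)

theorem coeff_incl_of_not_dvd (b : ℕ+) (a : K) {m : ℤ} (h : ¬(b : ℤ) ∣ m) :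
    (incl b a).coeff m = 0 :=
  HahnSeries.embDomain_of_notMem_range (by
    rintro ⟨n, hn⟩
    exact h ⟨n, hn.symm⟩)

theorem incl_incl (b c : ℕ+) (a : K) : incl c (incl b a) = incl (c * b) a := by
  ext m
  by_cases h : (c : ℤ) ∣ m
  · obtain ⟨m, rfl⟩ := h
    rw [coeff_incl_mul]
    by_cases h : (b : ℤ) ∣ m
    · obtain ⟨m, rfl⟩ := h
      rw [coeff_incl_mul, ← mul_assoc]
      exact (coeff_incl_mul (c * b) a m).symm
    · rw [coeff_incl_of_not_dvd b a h, coeff_incl_of_not_dvd]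
      rintro ⟨n, hn⟩
      refine h ⟨n, ?_⟩
      have hc : (c : ℤ) ≠ 0 := by exact_mod_cast c.ne_zero
      refine mul_left_cancel₀ hc ?_
      rw [hn]
      push_cast
      ring
  · rw [coeff_incl_of_not_dvd c _ h, coeff_incl_of_not_dvd]
    rintro ⟨n, hn⟩
    exact h ⟨b * n, by rw [hn]; push_cast; ring⟩

theorem incl_one (a : K) : incl 1 a = a := by
  ext m
  simpa using coeff_incl_mul 1 a m

theorem euler_incl (b : ℕ+) (a : K) :
    euler (incl b a) = HahnSeries.C (b : ℂ) * incl b (d a) := by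
  have hb : ((b : ℕ) : ℂ) ≠ 0 := by exact_mod_cast b.ne_zero
  rw [← db_incl]
  change _ = HahnSeries.C (b : ℂ) * (HahnSeries.C ((b : ℂ)⁻¹) * euler (incl b a))
  rw [← mul_assoc, ← map_mul, mul_inv_cancel₀ hb, map_one, one_mul]

/-- An endomorphism of `ℂ((t)){x}` that is a ramification `t ↦ tᵇ` on the coefficients and sends
`x` to a differential polynomial of degree at most one. -/
def IsAffine (Φ : DiffPoly d →+* DiffPoly d) : Prop :=
  (∃ b : ℕ+, ∀ a, Φ (const d a) = const d (incl b a)) ∧ Φ (var d) ∈ degLT d 2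

theorem IsAffine.map_mem_degLT {Φ : DiffPoly d →+* DiffPoly d} (hΦ : IsAffine Φ) {n : ℕ}
    {f : DiffPoly d} (hf : f ∈ degLT d n) : Φ f ∈ degLT d n := by
  obtain ⟨⟨b, hb⟩, hv⟩ := hΦ
  exact DiffPoly.map_mem_degLT hb hv hf

theorem IsAffine.map_mem_linProd {Φ : DiffPoly d →+* DiffPoly d} (hΦ : IsAffine Φ)
    {f : DiffPoly d} (hf : f ∈ linProd d) : Φ f ∈ linProd d := by
  obtain ⟨⟨b, hb⟩, hv⟩ := hΦ
  exact DiffPoly.map_mem_linProd hb hv hf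

theorem isAffine_id : IsAffine (RingHom.id (DiffPoly d)) :=
  ⟨⟨1, fun a => by rw [RingHom.id_apply, incl_one]⟩,
    by simpa using (isMonicOfDeg_var_pow (d := d) 1).2⟩

theorem IsAffine.comp {Φ Ψ : DiffPoly d →+* DiffPoly d} (hΦ : IsAffine Φ) (hΨ : IsAffine Ψ) :
    IsAffine (Φ.comp Ψ) := by
  refine ⟨?_, hΦ.map_mem_degLT hΨ.2⟩
  obtain ⟨b, hb⟩ := hΦ.1
  obtain ⟨c, hc⟩ := hΨ.1
  exact ⟨b * c, fun a => by rw [RingHom.comp_apply, hc, hb, incl_incl]⟩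

/-- The translation `x ↦ x - a`. -/
noncomputable def translate (a : K) : DiffPoly d →+* DiffPoly d :=
  lift (const d) (var d - const d a) fun c => by
    rw [sub_mul, mul_sub, var_mul_const, ← map_mul, ← map_mul, mul_comm a]
    abel

theorem isAffine_translate (a : K) : IsAffine (translate a) := by
  refine ⟨⟨1, fun c => by rw [translate, lift_const, incl_one]⟩, ?_⟩
  rw [translate, lift_var]
  exact (isMonicOfDeg_var_sub_const a).2

theorem isMonicOfDeg_var_sub_const_pow (a : K) (n : ℕ) :
    IsMonicOfDeg ((var d - const d a) ^ n) n := by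
  induction n with
  | zero => exact isMonicOfDeg_one
  | succ n ih =>
    rw [pow_succ]
    exact ih.mul (isMonicOfDeg_var_sub_const a)

theorem coeff_var_sub_const_pow (a : K) (n : ℕ) :
    coeff n ((var d - const d a) ^ (n + 1)) = -((n + 1 : ℕ) * a) := by
  induction n with
  | zero =>
    rw [zero_add, pow_one, map_sub, ← pow_one (var d), coeff_var_pow, if_neg one_ne_zero, zero_sub,
      ← mul_one (const d a), coeff_const_mul, isMonicOfDeg_one.1, mul_one, Nat.cast_one, one_mul]
  | succ n ih =>
    have h1 := (isMonicOfDeg_var_sub_const_pow a (n + 1)).1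
    rw [pow_succ', sub_mul, map_sub, coeff_succ_var_mul, coeff_const_mul, ih, h1,
      der_one]
    push_cast
    ring

/-- A monic differential polynomial of degree `n + 1` can be translated so that its term of degree
`n` disappears. -/
theorem exists_translate {f : DiffPoly d} {n : ℕ} (hf : IsMonicOfDeg f (n + 1)) :
    ∃ Φ : DiffPoly d →+* DiffPoly d, IsAffine Φ ∧ IsMonicOfDeg (Φ f) (n + 1) ∧
      coeff n (Φ f) = 0 := by
  set a : K := coeff n f / (n + 1 : ℕ) with ha
  have hn : ((n + 1 : ℕ) : K) ≠ 0 :=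
    haveI : CharZero K := charZero_of_injective_ringHom (HahnSeries.C_injective (Γ := ℤ) (R := ℂ))
    Nat.cast_ne_zero.mpr n.succ_ne_zero
  have hlow : f - var d ^ (n + 1) ∈ degLT d (n + 1) := hf.sub_mem (isMonicOfDeg_var_pow (n + 1))
  have hsum : f = var d ^ (n + 1) + (∑ i ∈ Finset.range n, const d (coeff i f) * var d ^ i
      + const d (coeff n f) * var d ^ n) := by
    conv_lhs => rw [eq_sum hf.2, Finset.sum_range_succ, Finset.sum_range_succ, hf.1, map_one,
      one_mul, add_comm]
  have hpow : ∀ i, translate a (var d ^ i) = (var d - const d a) ^ i := fun i => by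
    rw [map_pow, translate, lift_var]
  have hc : ∀ c, translate a (const d c) = const d c := fun c => by rw [translate, lift_const]
  have hrest : translate a (∑ i ∈ Finset.range n, const d (coeff i f) * var d ^ i) ∈ degLT d n :=
    (isAffine_translate a).map_mem_degLT <| sum_mem fun i hi => const_mul_mem_degLT _
      (degLT_mono (Finset.mem_range.mp hi) (isMonicOfDeg_var_pow i).2)
  refine ⟨translate a, isAffine_translate a, ?_, ?_⟩
  · have h : f = var d ^ (n + 1) + (f - var d ^ (n + 1)) := by abel
    rw [h, map_add, hpow]
    exact (isMonicOfDeg_var_sub_const_pow a (n + 1)).add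
      ((isAffine_translate a).map_mem_degLT hlow)
  · have h1 := (isMonicOfDeg_var_sub_const_pow a n).1
    rw [hsum, map_add (translate a), map_add (translate a), map_mul (translate a), hpow, hpow, hc,
      map_add, map_add, hrest n le_rfl,
      coeff_var_sub_const_pow, coeff_const_mul, h1, ha]
    field_simp
    ring

/-- The ramification `t ↦ tᵇ`, `x ↦ x / b`. -/
noncomputable def ramify (b : ℕ+) : DiffPoly d →+* DiffPoly d :=
  lift ((const d).comp (incl b)) (const d (HahnSeries.C ((b : ℂ)⁻¹)) * var d) fun a => by
    have h : HahnSeries.C ((b : ℂ)⁻¹) * d (incl b a) = incl b (d a) := db_incl b a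
    simp only [RingHom.comp_apply]
    rw [mul_assoc, var_mul_const, mul_add, ← map_mul, h, ← mul_assoc, ← mul_assoc, ← map_mul,
      ← map_mul, mul_comm (HahnSeries.C _)]

theorem ramify_const (b : ℕ+) (a : K) : ramify b (const d a) = const d (incl b a) :=
  lift_const _ _ _ _

theorem ramify_var (b : ℕ+) :
    ramify b (var d) = const d (HahnSeries.C ((b : ℂ)⁻¹)) * var d := lift_var _ _ _

theorem isAffine_ramify (b : ℕ+) : IsAffine (ramify b) := by
  refine ⟨⟨b, ramify_const b⟩, ?_⟩
  rw [ramify_var]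
  simpa using linear_mem_degLT (d := d) (HahnSeries.C ((b : ℂ)⁻¹)) 0

theorem ramify_var_pow (b : ℕ+) (i : ℕ) :
    ramify b (var d ^ i) = const d (HahnSeries.C ((b : ℂ)⁻¹ ^ i)) * var d ^ i := by
  have hcomm : Commute (const d (HahnSeries.C ((b : ℂ)⁻¹))) (var d) := by
    have h0 : d (HahnSeries.C ((b : ℂ)⁻¹)) = 0 := by
      rw [HahnSeries.C_apply, d, euler_single, Int.cast_zero, zero_mul, HahnSeries.single_eq_zero]
    change _ * _ = _ * _
    rw [var_mul_const, h0, map_zero, add_zero]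
  rw [map_pow, ramify_var, hcomm.mul_pow, ← map_pow, ← map_pow]

theorem coeff_ramify (b : ℕ+) (f : DiffPoly d) (i : ℕ) :
    coeff i (ramify b f) = HahnSeries.C ((b : ℂ)⁻¹ ^ i) * incl b (coeff i f) := by
  have h : (DiffPoly.coeff i).comp (ramify b).toAddMonoidHom = (AddMonoidHom.mulLeft
      (HahnSeries.C ((b : ℂ)⁻¹ ^ i))).comp ((incl b).toAddMonoidHom.comp (DiffPoly.coeff i)) :=
    addHom_ext fun a n => by
      change coeff i (ramify b (const d a * var d ^ n))
        = HahnSeries.C ((b : ℂ)⁻¹ ^ i) * incl b (coeff i (const d a * var d ^ n))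
      rw [map_mul, ramify_var_pow, ramify_const, ← mul_assoc, ← map_mul, coeff_const_mul_var_pow,
        coeff_const_mul_var_pow]
      split_ifs with h
      · rw [h, mul_comm]
      · rw [map_zero, mul_zero]
  exact DFunLike.congr_fun h f

/-! ### Existence of a factorisation -/

/-- After an affine change of variables, a monic differential polynomial of degree at least two
is a product of two factors of smaller degree. -/
theorem exists_isAffine_eq_mul {f : DiffPoly d} {n : ℕ} (hf : IsMonicOfDeg f (n + 2)) :
    ∃ Φ : DiffPoly d →+* DiffPoly d, IsAffine Φ ∧
      ∃ g ∈ degLT d (n + 2), ∃ h ∈ degLT d (n + 2), Φ f = g * h := by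
  obtain ⟨Φ, hΦ, hf1, hf0⟩ := exists_translate hf
  set f₁ := Φ f with hf₁
  -- As all `n + 2 - i` divide `b`, the slopes become integers.
  obtain ⟨b, hb⟩ : ∃ b : ℕ+, ∀ i < n + 2, ((n + 2 - i : ℕ) : ℤ) ∣ (b : ℤ) :=
    ⟨⟨(n + 2).factorial, Nat.factorial_pos _⟩, fun i hi => by
      exact_mod_cast Nat.dvd_factorial (by omega) (by omega)⟩
  have hb0 : (b : ℂ) ≠ 0 := by exact_mod_cast b.ne_zero
  set c : ℂ := (b : ℂ) ^ (n + 2) with hc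
  set f₂ := const d (HahnSeries.C c) * ramify b f₁ with hf₂
  have hcoeff : ∀ i, coeff i f₂
      = HahnSeries.C (c * (b : ℂ)⁻¹ ^ i) * incl b (coeff i f₁) := fun i => by
    rw [hf₂, coeff_const_mul, coeff_ramify, ← mul_assoc, ← map_mul]
  have hmonic : IsMonicOfDeg f₂ (n + 2) := by
    refine ⟨?_, const_mul_mem_degLT _ ((isAffine_ramify b).map_mem_degLT hf1.2)⟩
    rw [hcoeff, hf1.1, map_one, mul_one, hc, ← mul_pow, mul_inv_cancel₀ hb0, one_pow, map_one]
  have hzero : coeff (n + 1) f₂ = 0 := by rw [hcoeff, hf0, map_zero, mul_zero]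
  have hdvd : ∀ i j, (coeff i f₂).coeff j ≠ 0 → (b : ℤ) ∣ j := by
    intro i j hij
    by_contra h
    refine hij ?_
    rw [hcoeff, HahnSeries.C_mul_eq_smul, HahnSeries.coeff_smul, coeff_incl_of_not_dvd b _ h,
      smul_zero]
  have hback : ramify b f₁ = const d (HahnSeries.C c⁻¹) * f₂ := by
    rw [hf₂, ← mul_assoc, ← map_mul, ← map_mul, inv_mul_cancel₀ (pow_ne_zero _ hb0), map_one,
      map_one, one_mul]
  -- It suffices to factor `f₂`.
  suffices h : ∃ g ∈ degLT d (n + 2), ∃ h ∈ degLT d (n + 2), f₂ = g * h by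
    obtain ⟨g, hg, h, hh, hgh⟩ := h
    refine ⟨(ramify b).comp Φ, (isAffine_ramify b).comp hΦ, const d (HahnSeries.C c⁻¹) * g,
      const_mul_mem_degLT _ hg, h, hh, ?_⟩
    rw [RingHom.comp_apply, ← hf₁, hback, hgh, mul_assoc]
  -- The least integral slope `k` such that the Newton polygon lies above the line of slope `k`.
  have hex : ∃ k : ℕ, ∀ i < n + 2, ∀ j : ℤ, j < -((k * (n + 2 - i) : ℕ) : ℤ) →
      (coeff i f₂).coeff j = 0 := by
    refine ⟨∑ i ∈ Finset.range (n + 2), (coeff i f₂).order.natAbs, fun i hi j hj => ?_⟩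
    refine HahnSeries.coeff_eq_zero_of_lt_order ?_
    have h1 : (coeff i f₂).order.natAbs
        ≤ ∑ i ∈ Finset.range (n + 2), (coeff i f₂).order.natAbs :=
      Finset.single_le_sum (f := fun i => (coeff i f₂).order.natAbs) (fun _ _ => Nat.zero_le _)
        (Finset.mem_range.mpr hi)
    have h2 := Nat.le_mul_of_pos_right
      (∑ i ∈ Finset.range (n + 2), (coeff i f₂).order.natAbs) (by omega : 0 < n + 2 - i)
    omega
  classical
  set k := Nat.find hex with hk
  have hslope := Nat.find_spec hex
  rw [← hk] at hslope
  let p : ℂ[X] := X ^ (n + 2) + ∑ i ∈ Finset.range (n + 2),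
    C ((coeff i f₂).coeff (-((k * (n + 2 - i) : ℕ) : ℤ))) * X ^ i
  have hpdeg : (∑ i ∈ Finset.range (n + 2),
      C ((coeff i f₂).coeff (-((k * (n + 2 - i) : ℕ) : ℤ))) * X ^ i).degree
        < ((n + 2 : ℕ) : WithBot ℕ) := by
    refine (degree_sum_le _ _).trans_lt ((Finset.sup_lt_iff (WithBot.bot_lt_coe _)).mpr ?_)
    intro i hi
    exact (degree_C_mul_X_pow_le _ _).trans_lt (by exact_mod_cast Finset.mem_range.mp hi)
  have hpm : p.Monic := monic_X_pow_add hpdeg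
  have hpn : p.natDegree = n + 2 :=
    natDegree_eq_of_degree_eq_some <| by
      rw [degree_add_eq_left_of_degree_lt (by rwa [degree_X_pow]), degree_X_pow]
  have hpc : ∀ i < n + 2, p.coeff i = (coeff i f₂).coeff (-((k * (n + 2 - i) : ℕ) : ℤ)) := by
    intro i hi
    simp only [p, Polynomial.coeff_add, coeff_X_pow, finsetSum_coeff, coeff_C_mul, mul_ite,
      mul_one, mul_zero, Finset.sum_ite_eq, Finset.mem_range, if_pos hi, if_neg hi.ne, zero_add]
  have hfinish : ∀ q r : ℂ[X], q.Monic → r.Monic → p = q * r → q.natDegree ≠ 0 →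
      r.natDegree ≠ 0 → (∀ m : ℕ, 1 ≤ m → IsCoprime (q.comp (X + C ((m : ℂ) * 0 ^ k))) r) →
      ∃ g ∈ degLT d (n + 2), ∃ h ∈ degLT d (n + 2), f₂ = g * h := by
    intro q r hq hr hpqr hq0 hr0 hqr
    have hdeg : q.natDegree + r.natDegree = n + 2 := by rw [← hq.natDegree_mul hr, ← hpqr, hpn]
    obtain ⟨g, hg, h, hh, hgh⟩ := exists_eq_mul_of_slope hmonic hslope hq hr hdeg
      (fun i hi => by rw [← hpqr, hpc i hi]) hqr
    exact ⟨g, degLT_mono (by omega) hg, h, degLT_mono (by omega) hh, hgh⟩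
  rcases Nat.eq_zero_or_pos k with hk0 | hkpos
  · obtain ⟨q, α, hq, hpq, hcop⟩ := exists_mul_X_sub_C_isCoprime_comp hpm (by omega)
    have hdeg := hq.natDegree_mul (monic_X_sub_C α)
    rw [← hpq, hpn, natDegree_X_sub_C] at hdeg
    refine hfinish q (X - C α) hq (monic_X_sub_C α) hpq (by omega) (by simp) fun m hm => ?_
    simpa [hk0] using hcop m hm
  · have hpn1 : p.coeff (n + 1) = 0 := by
      rw [hpc _ (by omega), hzero, HahnSeries.coeff_zero]
    have hpX : p ≠ X ^ (n + 2) := by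
      intro hX
      have hmin := Nat.find_min hex (show k - 1 < k by omega)
      push Not at hmin
      obtain ⟨i, hi, j, hj, hij⟩ := hmin
      -- `j` is a multiple of `n + 2 - i` in the range `[-k (n + 2 - i), -(k - 1) (n + 2 - i))`.
      obtain ⟨u, rfl⟩ := (hb i hi).trans (hdvd i j hij)
      have hpos : (0 : ℤ) < ((n + 2 - i : ℕ) : ℤ) := by omega
      have h1 : -(k : ℤ) ≤ u := by
        by_contra hlt
        refine hij (hslope i hi _ ?_)
        push_cast
        nlinarith
      have h2 : u < -(k : ℤ) + 1 := by
        rw [Nat.cast_mul, Nat.cast_sub hkpos] at hj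
        push_cast at hj
        nlinarith
      have h3 : u = -(k : ℤ) := by omega
      have h4 := hpc i hi
      rw [hX, coeff_X_pow, if_neg hi.ne] at h4
      refine hij ?_
      rw [h4, h3]
      congr 1
      push_cast
      ring
    obtain ⟨q, r, hq, hr, hpqr, hcop, hq0, hr0⟩ := exists_isCoprime_mul hpm hpn hpn1 hpX
    refine hfinish q r hq hr hpqr hq0 hr0 fun m _ => ?_
    simpa [zero_pow hkpos.ne'] using hcop

/-- After an affine change of variables, every differential polynomial is a product of factors of
degree at most one. -/
theorem exists_isAffine_mem_linProd (n : ℕ) : ∀ f ∈ degLT d (n + 1),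
    ∃ Φ : DiffPoly d →+* DiffPoly d, IsAffine Φ ∧ Φ f ∈ linProd d := by
  induction n with
  | zero =>
    intro f hf
    exact ⟨_, isAffine_id, mem_linProd_of_degLT (degLT_mono one_le_two hf)⟩
  | succ n ih =>
    intro f hf
    by_cases h0 : coeff (n + 1) f = 0
    · refine ih f fun i hi => ?_
      rcases hi.eq_or_lt with rfl | hi
      · exact h0
      · exact hf i hi
    rcases n with _ | n
    · exact ⟨_, isAffine_id, mem_linProd_of_degLT hf⟩
    set a := coeff (n + 2) f with ha
    have hmonic : IsMonicOfDeg (const d a⁻¹ * f) (n + 2) :=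
      ⟨by rw [coeff_const_mul, ← ha, inv_mul_cancel₀ h0], const_mul_mem_degLT _ hf⟩
    have hfa : f = const d a * (const d a⁻¹ * f) := by
      rw [← mul_assoc, ← map_mul, mul_inv_cancel₀ h0, map_one, one_mul]
    obtain ⟨Φ, hΦ, g, hg, h, hh, hgh⟩ := exists_isAffine_eq_mul hmonic
    obtain ⟨Φ₁, hΦ₁, hg₁⟩ := ih g hg
    obtain ⟨Φ₂, hΦ₂, hh₂⟩ := ih (Φ₁ h) (hΦ₁.map_mem_degLT hh)
    refine ⟨Φ₂.comp (Φ₁.comp Φ), hΦ₂.comp (hΦ₁.comp hΦ), ?_⟩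
    rw [hfa, map_mul]
    refine mul_mem ((hΦ₂.comp (hΦ₁.comp hΦ)).map_mem_linProd (const_mem_linProd a)) ?_
    rw [RingHom.comp_apply, RingHom.comp_apply, hgh, map_mul, map_mul]
    exact mul_mem (hΦ₂.map_mem_linProd hg₁) hh₂

/-- The commutation rule determines the leading coefficient of the image of `x` under an affine
endomorphism. -/
theorem IsAffine.exists_map_var {Φ : DiffPoly d →+* DiffPoly d} (hΦ : IsAffine Φ) :
    ∃ (b : ℕ+) (β : K), (∀ a, Φ (const d a) = const d (incl b a)) ∧
      Φ (var d) = const d (HahnSeries.C ((b : ℂ)⁻¹)) * var d + const d β := by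
  obtain ⟨⟨b, hb⟩, hv⟩ := hΦ
  refine ⟨b, coeff 0 (Φ (var d)), hb, ?_⟩
  set α := coeff 1 (Φ (var d)) with hα
  set β := coeff 0 (Φ (var d)) with hβ
  have hform : Φ (var d) = const d α * var d + const d β := by
    conv_lhs => rw [eq_sum hv, Finset.sum_range_succ, Finset.sum_range_one, ← hα, ← hβ]
    rw [pow_zero, pow_one, mul_one, add_comm]
  set t : K := HahnSeries.single 1 1 with ht
  have hdt : d t = t := by rw [ht, d, euler_single, Int.cast_one, one_mul]
  have ht0 : incl b t ≠ 0 := by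
    refine (_root_.map_ne_zero (incl b)).mpr ?_
    exact HahnSeries.single_ne_zero one_ne_zero
  -- Compare the constant terms of the images of both sides of `x t = t x + t`.
  have hcomm := congrArg Φ (var_mul_const d t)
  rw [map_add, map_mul, map_mul, hb, hb, hform, hdt] at hcomm
  have h0 := congrArg (DiffPoly.coeff 0) hcomm
  have hconst : ∀ a : K, coeff 0 (const d a) = a := fun a => by
    simpa using coeff_const_mul_var_pow (d := d) 0 0 a
  have hvar : coeff 0 (var d) = 0 := by simpa using coeff_var_pow (d := d) 0 1
  rw [add_mul, mul_add, mul_assoc, map_add, map_add, map_add, coeff_const_mul, coeff_zero_var_mul,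
    coeff_const_mul, coeff_const_mul, coeff_const_mul, coeff_const_mul, hconst, hconst, hvar] at h0
  have he : d (incl b t) = HahnSeries.C (b : ℂ) * incl b t := by
    have := euler_incl b t
    rwa [hdt] at this
  rw [he] at h0
  have hb0 : ((b : ℕ) : ℂ) ≠ 0 := by exact_mod_cast b.ne_zero
  have hα1 : α * HahnSeries.C (b : ℂ) = 1 := by
    refine mul_right_cancel₀ ht0 ?_
    linear_combination h0
  rw [hform, map_inv₀, eq_inv_of_mul_eq_one_left hα1]

/-- The homomorphism `ℂ((s)){x, s d/ds} → K_b{x}`, `x ↦ b (x - β)`. -/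
noncomputable def toKb (b : ℕ+) (β : K) : DiffPoly d →+* DiffPoly (db b) :=
  lift (const (db b)) (const (db b) (HahnSeries.C (b : ℂ)) * (var (db b) - const (db b) β))
    fun a => by
      have hb : ((b : ℕ) : ℂ) ≠ 0 := by exact_mod_cast b.ne_zero
      have h : HahnSeries.C (b : ℂ) * db b a = d a := by
        change HahnSeries.C (b : ℂ) * (HahnSeries.C ((b : ℂ)⁻¹) * euler a) = euler a
        rw [← mul_assoc, ← map_mul, mul_inv_cancel₀ hb, map_one, one_mul]
      have hswap : (var (db b) - const (db b) β) * const (db b) a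
          = const (db b) a * (var (db b) - const (db b) β) + const (db b) (db b a) := by
        rw [sub_mul, mul_sub, var_mul_const, ← map_mul, ← map_mul, mul_comm a]
        abel
      rw [mul_assoc, hswap, mul_add, ← mul_assoc, ← mul_assoc, ← map_mul, ← map_mul, h, ← map_mul,
        mul_comm a]

theorem baseChange_mem_linProd {Φ : DiffPoly d →+* DiffPoly d} {b : ℕ+} {β : K}
    (hc : ∀ a, Φ (const d a) = const d (incl b a))
    (hv : Φ (var d) = const d (HahnSeries.C ((b : ℂ)⁻¹)) * var d + const d β) {f : DiffPoly d}
    (hf : Φ f ∈ linProd d) : baseChange b f ∈ linProd (db b) := by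
  have hb : ((b : ℕ) : ℂ) ≠ 0 := by exact_mod_cast b.ne_zero
  have hcc : ∀ a, toKb b β (const d a) = const (db b) a := lift_const _ _ _
  have htv : toKb b β (var d)
      = const (db b) (HahnSeries.C (b : ℂ)) * (var (db b) - const (db b) β) := lift_var _ _ _
  have h : baseChange b = (toKb b β).comp Φ := by
    refine ringHom_ext (fun a => ?_) ?_
    · rw [RingHom.comp_apply, hc, hcc]
      exact Polynomial.map_C (incl b)
    · rw [RingHom.comp_apply, hv, map_add, map_mul, hcc, hcc, htv, ← mul_assoc, ← map_mul,
        ← map_mul, inv_mul_cancel₀ hb, map_one, map_one, one_mul, sub_add_cancel]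
      exact Polynomial.map_X (incl b)
  rw [h, RingHom.comp_apply]
  refine DiffPoly.map_mem_linProd (φ := RingHom.id K) hcc ?_ hf
  rw [htv]
  exact const_mul_mem_degLT _ (isMonicOfDeg_var_sub_const β).2

theorem coeff_baseChange (b : ℕ+) (f : DiffPoly d) (i : ℕ) :
    coeff i (baseChange b f) = incl b (coeff i f) :=
  Polynomial.coeff_map (incl b) i

end FormalLaurent

open FormalLaurent in
theorem theorem1p11 (f : DiffPoly d) :
    ∃ (b : ℕ+) (Λ : List (Kb b)),
      Λ.length = DiffPoly.natDegree d f ∧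
      baseChange b f =
        DiffPoly.const (db b) (incl b (DiffPoly.leadingCoeff d f)) *
          (Λ.map fun a => DiffPoly.var (db b) - DiffPoly.const (db b) a).prod := by
  by_cases hf : f = 0
  · refine ⟨1, [], ?_, ?_⟩
    · rw [hf]
      exact Polynomial.natDegree_zero.symm
    · have h : DiffPoly.leadingCoeff d f = 0 := by
        rw [hf]
        exact Polynomial.leadingCoeff_zero
      rw [h, hf, map_zero, map_zero, map_zero, zero_mul]
  obtain ⟨n, hn⟩ := DiffPoly.exists_bound f
  obtain ⟨Φ, hΦ, hmem⟩ := exists_isAffine_mem_linProd n f (DiffPoly.degLT_mono n.le_succ hn)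
  obtain ⟨b, β, hc, hv⟩ := hΦ.exists_map_var
  obtain ⟨a, Λ, hΛ⟩ := DiffPoly.exists_const_mul_prod (baseChange_mem_linProd hc hv hmem)
  have hprod := DiffPoly.isMonicOfDeg_prod (d := db b) Λ
  have hcoeff : ∀ i, incl b (DiffPoly.coeff i f) = a * DiffPoly.coeff i
      (Λ.map fun a => DiffPoly.var (db b) - DiffPoly.const (db b) a).prod := fun i => by
    rw [← coeff_baseChange, hΛ, DiffPoly.coeff_const_mul]
  have hlead : incl b (DiffPoly.coeff Λ.length f) = a := by rw [hcoeff, hprod.1, mul_one]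
  have hdeg : DiffPoly.natDegree d f = Λ.length := by
    refine natDegree_eq_of_le_of_coeff_ne_zero ?_ fun h0 => hf (DiffPoly.ext_coeff fun i => ?_)
    · refine natDegree_le_iff_coeff_eq_zero.mpr fun i hi => ?_
      refine (map_eq_zero (incl b)).mp ((hcoeff i).trans ?_)
      rw [hprod.2 i hi, mul_zero]
    · have ha : a = 0 := by
        rw [← hlead]
        exact (congrArg (incl b) h0).trans (map_zero _)
      refine (map_eq_zero (incl b)).mp ((hcoeff i).trans ?_) |>.trans (map_zero _).symm
      rw [ha, zero_mul]
  refine ⟨b, Λ, hdeg.symm, ?_⟩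
  have hl : incl b (DiffPoly.leadingCoeff d f) = a := by
    rw [← hlead, ← hdeg]
    rfl
  rw [hl, hΛ]
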